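/- Let $K$ be a finite (abstract) simplicial complex with vertex set $V$, made into an ordered simplicial complex by a partial order on $V$ that is total on every simplex (for example a total order on $V$), and let $n \ge 2$. Let $K^n$ be the $n$-fold product of ordered simplicial complexes: its vertex set is $V^n$, and its simplices are the nonempty finite chains of $V^n$ in the product order whose $n$ coordinate projections are simplices of $K$. The symmetric group $\Sigma_n$ acts on $K^n$ by $g(v_1,\dots,v_n)=(v_{g(1)},\dots,v_{g(n)})$, and hence on all iterated barycentric subdivisions $\operatorname{sd}^r(K^n)$. For each $r\ge 0$ choose a $\Sigma_n$-equivariant simplicial approximation $\operatorname{sd}^{r+1}(K^n)\to \operatorname{sd}^r(K^n)$ of the identity of $|K^n|$ (such approximations exist); let $\iota^r:\operatorname{sd}^r(K^n)\to K^n$ be the composite of the first $r$ of them and let $\pi_j=p_j\circ\iota^r:\operatorname{sd}^r(K^n)\to K$, where $p_j$ is the $j$-th projection, $1\le j\le n$. Simplicial maps $\varphi_1,\dots,\varphi_n:L\to K$ on a simplicial $\Sigma_n$-complex $L$ with $\varphi_j(gv)=\varphi_{g(j)}(v)$ are called symmetrically contiguous if there are a simplicial map $\varphi_*:L\to K$ with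 $\varphi_*(gv)=\varphi_*(v)$, an integer $c\ge 1$ and, for each $j$, simplicial maps $\varphi_*=\varphi_j^0,\varphi_j^1,\dots,\varphi_j^c=\varphi_j:L\to K$ such that $\varphi_j^{l-1}(\sigma)\cup\varphi_j^{l}(\sigma)$ is a simplex of $K$ for every simplex $\sigma$ of $L$ and $\varphi_j^l(gv)=\varphi_{g(j)}^l(v)$, for all $1\le l\le c$, $1\le j\le n$, $g\in\Sigma_n$ and all vertices $v$ of $L$. Let $\mathsf{SC}^{\Sigma,r}_n(K)$ be the least $k\geq 0$ such that $\operatorname{sd}^r(K^n)$ is covered by $k$ $\Sigma_n$-invariant subcomplexes on each of which the restrictions of $\pi_1,\dots,\pi_n$ are symmetrically contiguous ($\infty$ if there is no such $k$), and let $\mathsf{SC}^\Sigma_n(K)=\min_{r\ge 0}\mathsf{SC}^{\Sigma,r}_n(K)$. For a topological space $X$ let $I_n$ be the wedge of $n$ copies $[0,1]_1,\dots,[0,1]_n$ of the unit interval at their points $0$, write $t_j$ for the point $t$ of $[0,1]_j$, let $X^{I_n}$ be the space of continuous maps with the compact-open topology and with the action $(g\alpha)(t_j)=\alpha(t_{g(j)})$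 of $\Sigma_n$, let $\Sigma_n$ act on $X^n$ by $g(x_1,\dots,x_n)=(x_{g(1)},\dots,x_{g(n)})$, and let $e_n:X^{I_n}\to X^n$, $\alpha\mapsto(\alpha(1_1),\dots,\alpha(1_n))$. Let $\mathsf{TC}^\Sigma_n(X)$ be the least $k\geq 0$ such that $X^n$ is covered by $k$ $\Sigma_n$-invariant open subsets on each of which $e_n$ has a continuous $\Sigma_n$-equivariant section ($\infty$ if there is no such $k$). Then, for every such order on $V$ and every such choice of approximations, $$\mathsf{SC}^\Sigma_n(K)=\mathsf{TC}^\Sigma_n(|K|),$$ where $|K|$ is the geometric realization of $K$ (both sides may be $\infty$). -/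

import Mathlib

universe u

namespace HigherSym

/-! ### The symmetric group and its action on powers

`Sym n` is the symmetric group on `n` letters with the composition for which
`(g • x) j = x (g j)` is an action on `Fin n → X`
(Mathlib's action of the tag `DomMulAct`).  `perm g` is the underlying permutation. -/

abbrev Sym (n : ℕ) : Type := (Equiv.Perm (Fin n))ᵈᵐᵃ

/-- The permutation of `{1, …, n}` given by an element of `Sym n`. -/
def perm {n : ℕ} (g : Sym n) : Equiv.Perm (Fin n) := DomMulAct.mk.symm g

theorem sym_smul_apply {n : ℕ} {X : Type u} (g : Sym n) (x : Fin n → X) (j : Fin n) :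
    (g • x) j = x (perm g j) := rfl

/-! ### Equivariant sectional category -/

/-- `q : E → B` has a continuous `G`-equivariant section over the subset `U` of `B`. -/
def HasEquivariantSection (G : Type) {E B : Type u} [TopologicalSpace E] [TopologicalSpace B]
    [SMul G E] [SMul G B] (q : E → B) (U : Set B) : Prop :=
  ∃ s : U → E, Continuous s ∧ (∀ x : U, q (s x) = x) ∧
    ∀ (g : G) (x y : U), (y : B) = g • (x : B) → s y = g • s x

/-- The equivariant sectional category: the least `k` such that `B` is covered by `k` open
`G`-invariant subsets with `G`-equivariant sections of `q` over them; `⊤` if there is none. -/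
noncomputable def secatG (G : Type) {E B : Type u} [TopologicalSpace E] [TopologicalSpace B]
    [SMul G E] [SMul G B] (q : E → B) : ℕ∞ :=
  sInf {m : ℕ∞ | ∃ k : ℕ, m = k ∧ ∃ U : Fin k → Set B,
    (∀ i, IsOpen (U i)) ∧ (∀ i, ∀ g : G, ∀ x ∈ U i, g • x ∈ U i) ∧ (⋃ i, U i) = Set.univ ∧
    ∀ i, HasEquivariantSection G q (U i)}

/-! ### The wedge of `n` intervals and the higher symmetric topological complexity -/

/-- The points `(0, j)` of `[0,1] × {1, …, n}` are identified with each other. -/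
def wedgeSetoid (n : ℕ) : Setoid (unitInterval × Fin n) where
  r a b := a = b ∨ (a.1 = 0 ∧ b.1 = 0)
  iseqv :=
    { refl := fun _ => Or.inl rfl
      symm := by
        rintro a b (h | h)
        · exact Or.inl h.symm
        · exact Or.inr ⟨h.2, h.1⟩
      trans := by
        rintro a b c (rfl | h) (rfl | h')
        · exact Or.inl rfl
        · exact Or.inr h'
        · exact Or.inr h
        · exact Or.inr ⟨h.1, h'.2⟩ }

/-- The wedge `I_n` of `n` copies of `[0,1]` at the points `0`, with the quotient topology. -/
def Wedge (n : ℕ) : Type := Quotient (wedgeSetoid n)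

instance (n : ℕ) : TopologicalSpace (Wedge n) :=
  inferInstanceAs (TopologicalSpace (Quotient (wedgeSetoid n)))

/-- The point `t_j` of the wedge: parameter `t` in the `j`-th interval. -/
def Wedge.pt {n : ℕ} (t : unitInterval) (j : Fin n) : Wedge n :=
  Quotient.mk (wedgeSetoid n) (t, j)

/-- A permutation `g` acts on the wedge by `g t_j = t_{g j}`. -/
def Wedge.act {n : ℕ} (g : Equiv.Perm (Fin n)) : Wedge n → Wedge n :=
  Quotient.map (fun a => (a.1, g a.2)) (by
    rintro a b (rfl | h)
    · exact Or.inl rfl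
    · exact Or.inr h)

theorem Wedge.continuous_act {n : ℕ} (g : Equiv.Perm (Fin n)) :
    Continuous (Wedge.act g) := by
  refine continuous_quot_lift _ ?_
  refine continuous_quot_mk.comp ?_
  exact continuous_fst.prodMk (continuous_of_discreteTopology.comp continuous_snd)

/-- `Σ_n` acts on the mapping space `X^{I_n}` (compact-open topology) by
`(g α)(t_j) = α(t_{g j})`. -/
instance (n : ℕ) (X : Type u) [TopologicalSpace X] : MulAction (Sym n) C(Wedge n, X) where
  smul g α := α.comp ⟨Wedge.act (perm g), Wedge.continuous_act _⟩
  one_smul α := by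
    ext w
    induction w using Quotient.inductionOn
    rfl
  mul_smul g h α := by
    ext w
    induction w using Quotient.inductionOn
    rfl

theorem smul_path_apply {n : ℕ} {X : Type u} [TopologicalSpace X] (g : Sym n)
    (α : C(Wedge n, X)) (t : unitInterval) (j : Fin n) :
    (g • α) (Wedge.pt t j) = α (Wedge.pt t (perm g j)) := rfl

/-- The evaluation `e_n : X^{I_n} → X^n`, `α ↦ (α(1_1), …, α(1_n))`. -/
def evalEnds (n : ℕ) (X : Type u) [TopologicalSpace X] (α : C(Wedge n, X)) : Fin n → X :=
  fun j => α (Wedge.pt 1 j)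

/-- The higher symmetric topological complexity `TC^Σ_n(X) = secat_{Σ_n}(e_n)`. -/
noncomputable def symTC (n : ℕ) (X : Type u) [TopologicalSpace X] : ℕ∞ :=
  secatG (Sym n) (evalEnds n X)

/-! ### Simplicial complexes -/

section Complexes

variable {V W : Type u}

/-- A vertex map that sends simplices to simplices. -/
def IsSimplicial (K : AbstractSimplicialComplex V) (L : AbstractSimplicialComplex W)
    (φ : V → W) : Prop :=
  open Classical in ∀ s ∈ K.faces, s.image φ ∈ L.faces

/-- One step of contiguity: `φ(σ) ∪ ψ(σ)` is a simplex for each simplex `σ`. -/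
def OneContiguous (K : AbstractSimplicialComplex V) (L : AbstractSimplicialComplex W)
    (φ ψ : V → W) : Prop :=
  open Classical in ∀ s ∈ K.faces, s.image φ ∪ s.image ψ ∈ L.faces

/-- The points of the geometric realization `|K|`: functions `V → [0,1]` whose support is a
simplex and whose values add up to `1`.  The topology is that of pointwise convergence, which is
the usual one when the vertex set is finite. -/
abbrev Realization (K : AbstractSimplicialComplex V) : Type u :=
  {α : V → ℝ // (∀ v, α v ∈ Set.Icc (0 : ℝ) 1) ∧
    ∃ s ∈ K.faces, (∀ v, v ∈ s ↔ α v ≠ 0) ∧ ∑ v ∈ s, α v = 1}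

/-- The open star of a vertex. -/
def openStar (K : AbstractSimplicialComplex V) (v : V) : Set (Realization K) :=
  {α | α.1 v ≠ 0}

/-- `φ` is a simplicial approximation of `f : |K| → |L|`. -/
def IsSimplicialApprox (K : AbstractSimplicialComplex V) (L : AbstractSimplicialComplex W)
    (f : Realization K → Realization L) (φ : V → W) : Prop :=
  ∀ v, f '' openStar K v ⊆ openStar L (φ v)

/-- The order complex of a poset: simplices are the nonempty finite chains. -/
def orderComplex (P : Type u) [PartialOrder P] : AbstractSimplicialComplex P where
  faces := {c | c.Nonempty ∧ IsChain (· ≤ ·) (c : Set P)}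
  isRelLowerSet_faces := fun _ hc =>
    ⟨hc.1, fun _ hts ht => ⟨ht, hc.2.mono (Finset.coe_subset.mpr hts)⟩⟩
  singleton_mem v := ⟨Finset.singleton_nonempty v, by simp⟩

/-- The barycentric subdivision: the order complex of the poset of simplices. -/
def sd (K : AbstractSimplicialComplex V) : AbstractSimplicialComplex K.faces :=
  orderComplex K.faces

/-- A nonempty finite chain has a greatest element. -/
theorem exists_greatest {P : Type u} [PartialOrder P] (c : Finset P) (hc : c.Nonempty)
    (h : IsChain (· ≤ ·) (c : Set P)) : ∃ m ∈ c, ∀ x ∈ c, x ≤ m := by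
  obtain ⟨m, hm⟩ := c.exists_maximal hc
  refine ⟨m, hm.1, fun x hx => ?_⟩
  rcases h.total hx hm.1 with h1 | h1
  · exact h1
  · exact hm.2 hx h1

/-- The coordinates of the point of `|K|` that corresponds to a point of `|sd K|`: the vertex
`σ` of `sd K` goes to the barycenter of `σ`, and the map is linear on simplices. -/
noncomputable def baryCoord (K : AbstractSimplicialComplex V) (β : K.faces → ℝ) (v : V) : ℝ :=
  open Classical in ∑ᶠ σ : K.faces, β σ * (if v ∈ σ.1 then ((σ.1.card : ℝ))⁻¹ else 0)

theorem baryCoord_eq_sum (K : AbstractSimplicialComplex V) (β : K.faces → ℝ)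
    (c : Finset K.faces) (hc : ∀ σ, σ ∈ c ↔ β σ ≠ 0) (v : V) :
    open Classical in
    baryCoord K β v = ∑ σ ∈ c, β σ * (if v ∈ σ.1 then ((σ.1.card : ℝ))⁻¹ else 0) := by
  classical
  unfold baryCoord
  refine finsum_eq_sum_of_support_subset _ ?_
  intro σ hσ
  rw [Finset.mem_coe, hc]
  intro h0
  exact hσ (by simp [h0])

theorem baryCoord_mem (K : AbstractSimplicialComplex V) (β : Realization (sd K)) :
    (∀ v, baryCoord K β.1 v ∈ Set.Icc (0 : ℝ) 1) ∧
    ∃ s ∈ K.faces, (∀ v, v ∈ s ↔ baryCoord K β.1 v ≠ 0) ∧ ∑ v ∈ s, baryCoord K β.1 v = 1 := by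
  classical
  obtain ⟨β, h01, c, hc, hsupp, hsum⟩ := β
  obtain ⟨m, hm, hmax⟩ := exists_greatest c hc.1 hc.2
  have key := baryCoord_eq_sum K β c hsupp
  have hnn : ∀ v, ∀ σ ∈ c, 0 ≤ β σ * (if v ∈ σ.1 then ((σ.1.card : ℝ))⁻¹ else 0) := by
    intro v σ _
    refine mul_nonneg (h01 σ).1 ?_
    split_ifs <;> positivity
  have h0 : ∀ v, 0 ≤ baryCoord K β v := fun v => by
    rw [key]; exact Finset.sum_nonneg (hnn v)
  have hs : ∀ v, v ∈ m.1 ↔ baryCoord K β v ≠ 0 := by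
    intro v
    rw [key]
    constructor
    · intro hv
      refine ne_of_gt (Finset.sum_pos' (hnn v) ⟨m, hm, ?_⟩)
      have h1 : 0 < β m := lt_of_le_of_ne (h01 m).1 (Ne.symm ((hsupp m).1 hm))
      have h2 : 0 < (m.1.card : ℝ) := by
        exact_mod_cast Finset.card_pos.mpr ⟨v, hv⟩
      rw [if_pos hv]
      positivity
    · intro h
      by_contra hv
      refine h (Finset.sum_eq_zero fun σ hσ => ?_)
      rw [if_neg (fun hvσ => hv (hmax σ hσ hvσ)), mul_zero]
  have htot : ∑ v ∈ m.1, baryCoord K β v = 1 := by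
    simp_rw [key]
    rw [Finset.sum_comm, ← hsum]
    refine Finset.sum_congr rfl fun σ hσ => ?_
    have hne : (σ.1.card : ℝ) ≠ 0 := by
      have := Finset.card_pos.mpr (K.isRelLowerSet_faces σ.2).1
      exact_mod_cast this.ne'
    rw [← Finset.mul_sum, Finset.sum_ite_mem,
      Finset.inter_eq_right.mpr (hmax σ hσ), Finset.sum_const, nsmul_eq_mul,
      mul_inv_cancel₀ hne, mul_one]
  refine ⟨fun v => ⟨h0 v, ?_⟩, m.1, m.2, hs, htot⟩
  by_cases hv : v ∈ m.1
  · refine le_trans ?_ htot.le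
    exact Finset.single_le_sum (f := fun v => baryCoord K β v) (fun w _ => h0 w) hv
  · have : baryCoord K β v = 0 := by
      by_contra hh
      exact hv ((hs v).2 hh)
    exact this.le.trans zero_le_one

/-- The canonical linear homeomorphism `|sd K| → |K|`, through which the two realizations are
identified. -/
noncomputable def sdRealization (K : AbstractSimplicialComplex V) :
    Realization (sd K) → Realization K :=
  fun β => ⟨baryCoord K β.1, baryCoord_mem K β⟩

end Complexes

/-! ### Simplicial complexes with a group action -/

/-- A simplicial `G`-complex: a simplicial complex with an action of `G` on the vertices that
sends simplices to simplices. -/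
structure GComplex (G : Type) [Group G] : Type (u + 1) where
  /-- the vertices -/
  V : Type u
  /-- the simplices -/
  cx : AbstractSimplicialComplex V
  [action : MulAction G V]
  map_face : ∀ (g : G), ∀ s ∈ cx.faces, s.map (MulAction.toPerm g).toEmbedding ∈ cx.faces

attribute [instance] GComplex.action

section GComplexes

variable {G : Type} [Group G]

/-- The barycentric subdivision of a simplicial `G`-complex, with the action
`g σ = {g v : v ∈ σ}`. -/
def GComplex.sd (M : GComplex.{u} G) : GComplex.{u} G where
  V := M.cx.faces
  cx := HigherSym.sd M.cx
  action :=
    { smul := fun g σ => ⟨σ.1.map (MulAction.toPerm g).toEmbedding, M.map_face g σ.1 σ.2⟩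
      one_smul := fun σ => by
        refine Subtype.ext (Finset.ext fun v => ?_)
        change v ∈ σ.1.map (MulAction.toPerm (1 : G)).toEmbedding ↔ _
        simp
      mul_smul := fun g h σ => by
        refine Subtype.ext (Finset.ext fun v => ?_)
        change v ∈ σ.1.map (MulAction.toPerm (g * h)).toEmbedding ↔
          v ∈ (σ.1.map (MulAction.toPerm h).toEmbedding).map (MulAction.toPerm g).toEmbedding
        simp [mul_smul] }
  map_face := by
    rintro g c ⟨hne, hc⟩
    refine ⟨hne.map, ?_⟩
    intro a ha b hb _
    rw [Finset.mem_coe, Finset.mem_map] at ha hb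
    obtain ⟨σ, hσ, rfl⟩ := ha
    obtain ⟨τ, hτ, rfl⟩ := hb
    rcases hc.total hσ hτ with h | h
    · exact Or.inl (Finset.map_subset_map.mpr h)
    · exact Or.inr (Finset.map_subset_map.mpr h)

/-- The iterated barycentric subdivisions. -/
def GComplex.sdIter (M : GComplex.{u} G) : ℕ → GComplex.{u} G
  | 0 => M
  | r + 1 => (M.sdIter r).sd

/-- A `G`-simplicial approximation `sd M → M` of the identity of `|M| = |sd M|`. -/
structure GComplex.ApproxId (M : GComplex.{u} G) where
  /-- the vertex map -/
  toFun : M.sd.V → M.V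
  simplicial : IsSimplicial M.sd.cx M.cx toFun
  approx : IsSimplicialApprox M.sd.cx M.cx (sdRealization M.cx) toFun
  equivariant : ∀ (g : G) (σ : M.sd.V), toFun (g • σ) = g • toFun σ

/-- A choice, for every `r`, of a `G`-approximation of the identity from the `(r+1)`-st to the
`r`-th subdivision of `M`. -/
abbrev GComplex.ApproxSystem (M : GComplex.{u} G) : Type u :=
  ∀ r : ℕ, (M.sdIter r).ApproxId

/-- The iterated composition `sd^r M → M`. -/
def GComplex.ApproxSystem.iter {M : GComplex.{u} G} (ι : M.ApproxSystem) :
    ∀ r : ℕ, (M.sdIter r).V → M.V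
  | 0 => fun v => v
  | r + 1 => fun v => GComplex.ApproxSystem.iter ι r ((ι r).toFun v)

/-- A simplicial `G`-complex whose vertices are ordered such that the simplices are chains and the
action is monotone has a `G`-approximation of the identity. -/
theorem GComplex.nonempty_approxId (M : GComplex.{u} G) [PartialOrder M.V]
    (hch : ∀ s ∈ M.cx.faces, IsChain (· ≤ ·) (s : Set M.V))
    (hmono : ∀ g : G, Monotone (fun v : M.V => g • v)) : Nonempty M.ApproxId := by
  classical
  have hex : ∀ σ : M.cx.faces, ∃ m ∈ σ.1, ∀ x ∈ σ.1, x ≤ m := fun σ =>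
    exists_greatest σ.1 (M.cx.isRelLowerSet_faces σ.2).1 (hch σ.1 σ.2)
  choose φ hφ hmax using hex
  refine ⟨⟨φ, ?_, ?_, ?_⟩⟩
  · intro (c : Finset M.cx.faces) hc
    obtain ⟨τ, hτ, hτmax⟩ := exists_greatest c hc.1 hc.2
    refine (M.cx.isRelLowerSet_faces τ.2).2 ?_ ?_
    · intro v hv
      obtain ⟨σ, hσ, rfl⟩ := Finset.mem_image.mp hv
      exact hτmax σ hσ (hφ σ)
    · exact ⟨φ τ, Finset.mem_image.mpr ⟨τ, hτ, by rfl⟩⟩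
  · rintro σ _ ⟨β, hβ, rfl⟩
    change baryCoord M.cx β.1 (φ σ) ≠ 0
    obtain ⟨β, h01, c, hc, hsupp, hsum⟩ := β
    rw [baryCoord_eq_sum M.cx β c hsupp]
    have hσ : β σ ≠ 0 := hβ
    refine ne_of_gt (Finset.sum_pos' (fun τ _ => ?_) ⟨σ, (hsupp σ).2 hσ, ?_⟩)
    · refine mul_nonneg (h01 τ).1 ?_
      split_ifs <;> positivity
    · have h1 : 0 < β σ := lt_of_le_of_ne (h01 σ).1 (Ne.symm hσ)
      have h2 : 0 < (σ.1.card : ℝ) := by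
        exact_mod_cast Finset.card_pos.mpr ⟨_, hφ σ⟩
      rw [if_pos (hφ σ)]
      positivity
  · intro g σ
    refine le_antisymm ?_ ?_
    · obtain ⟨x, hx, hgx⟩ := Finset.mem_map.mp (hφ (g • σ))
      rw [← hgx]
      exact hmono g (hmax σ x hx)
    · exact hmax (g • σ) _ (Finset.mem_map.mpr ⟨φ σ, hφ σ, rfl⟩)

/-- A symmetric subcomplex: a set of simplices closed under nonempty faces with `g L ⊆ L`
(hence `g L = L`) for all `g`. -/
structure InvSubcomplex (M : GComplex.{u} G) extends PreAbstractSimplicialComplex M.V where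
  subset_faces : faces ⊆ M.cx.faces
  invariant : ∀ (g : G), ∀ s ∈ faces, s.map (MulAction.toPerm g).toEmbedding ∈ faces

/-- A symmetric subcomplex as a simplicial `G`-complex on its own vertices. -/
def InvSubcomplex.toGComplex {M : GComplex.{u} G} (L : InvSubcomplex M) : GComplex.{u} G where
  V := {v : M.V // {v} ∈ L.faces}
  cx :=
    { faces := {s | s.map (Function.Embedding.subtype _) ∈ L.faces}
      isRelLowerSet_faces := fun s hs =>
        ⟨Finset.map_nonempty.mp (L.isRelLowerSet_faces hs).1, fun t hts ht =>
          (L.isRelLowerSet_faces hs).2 (Finset.map_subset_map.mpr hts) ht.map⟩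
      singleton_mem := fun v => by
        change Finset.map _ {v} ∈ L.faces
        rw [Finset.map_singleton]
        exact v.2 }
  action :=
    { smul := fun g v => ⟨g • v.1, by
        have h := L.invariant g _ v.2
        rwa [Finset.map_singleton] at h⟩
      one_smul := fun v => Subtype.ext (one_smul G v.1)
      mul_smul := fun g h v => Subtype.ext (mul_smul g h v.1) }
  map_face := by
    intro g s hs
    have h := L.invariant g _ hs
    change Finset.map _ (Finset.map _ s) ∈ L.faces
    rw [Finset.map_map] at h ⊢
    exact h

end GComplexes

/-! ### Higher symmetric simplicial complexity -/

/-- Symmetric contiguity of `φ_1, …, φ_n : M → K`: chains `φ_* = ψ_j^0, …, ψ_j^c = φ_j` of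
simplicial maps, consecutive ones being contiguous, with `φ_*(g v) = φ_*(v)` and
`ψ_j^l(g v) = ψ_{g j}^l(v)`. -/
def SymContiguous {n : ℕ} (M : GComplex.{u} (Sym n)) {W : Type u}
    (K : AbstractSimplicialComplex W) (φ : Fin n → M.V → W) : Prop :=
  (∀ j, IsSimplicial M.cx K (φ j)) ∧ (∀ (j : Fin n) (g : Sym n) (v : M.V), φ j (g • v) = φ (perm g j) v) ∧
  ∃ (φstar : M.V → W) (c : ℕ) (ψ : Fin n → ℕ → M.V → W),
    IsSimplicial M.cx K φstar ∧ (∀ (g : Sym n) (v : M.V), φstar (g • v) = φstar v) ∧ 1 ≤ c ∧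
    (∀ j, ψ j 0 = φstar) ∧ (∀ j, ψ j c = φ j) ∧
    (∀ j, ∀ l ≤ c, IsSimplicial M.cx K (ψ j l)) ∧
    (∀ j, ∀ l < c, OneContiguous M.cx K (ψ j l) (ψ j (l + 1))) ∧
    ∀ j, ∀ l, 1 ≤ l → l ≤ c → ∀ (g : Sym n) (v : M.V), ψ j l (g • v) = ψ (perm g j) l v

section Power

variable {V : Type u} [PartialOrder V]

/-- The partial order on the vertices makes `K` an ordered simplicial complex: it is total on
each simplex. -/
def IsOrderedComplex (K : AbstractSimplicialComplex V) : Prop :=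
  ∀ s ∈ K.faces, IsChain (· ≤ ·) (s : Set V)

open Classical in
/-- The `n`-fold cartesian product `K^n` of an ordered simplicial complex: simplices are the
nonempty finite chains of `V^n` (with the product order) all of whose projections are simplices
of `K`. -/
def powerComplex (K : AbstractSimplicialComplex V) (n : ℕ) :
    AbstractSimplicialComplex (Fin n → V) where
  faces := {s | s.Nonempty ∧ IsChain (· ≤ ·) (s : Set (Fin n → V)) ∧
    ∀ j, s.image (fun x => x j) ∈ K.faces}
  isRelLowerSet_faces := fun _ hs => ⟨hs.1, fun _ hts ht =>
    ⟨ht, hs.2.1.mono (Finset.coe_subset.mpr hts), fun j =>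
      (K.isRelLowerSet_faces (hs.2.2 j)).2 (Finset.image_subset_image hts) (ht.image _)⟩⟩
  singleton_mem := fun v => ⟨Finset.singleton_nonempty v, by simp, fun j => by
    rw [Finset.image_singleton]; exact K.singleton_mem _⟩

/-- The product `K^n` as a simplicial `Σ_n`-complex, with the action `(g v)_j = v_{g j}`. -/
def power (K : AbstractSimplicialComplex V) (n : ℕ) : GComplex.{u} (Sym n) where
  V := Fin n → V
  cx := powerComplex K n
  map_face := by
    classical
    rintro g s ⟨hne, hch, hK⟩
    refine ⟨hne.map, ?_, fun j => ?_⟩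
    · intro a ha b hb _
      rw [Finset.mem_coe, Finset.mem_map] at ha hb
      obtain ⟨x, hx, rfl⟩ := ha
      obtain ⟨y, hy, rfl⟩ := hb
      rcases hch.total hx hy with h | h
      · exact Or.inl fun j => h (perm g j)
      · exact Or.inr fun j => h (perm g j)
    · have h := hK (perm g j)
      convert h using 1
      ext v
      simp only [Finset.mem_image, Finset.mem_map]
      constructor
      · rintro ⟨_, ⟨x, hx, rfl⟩, rfl⟩
        exact ⟨x, hx, rfl⟩
      · rintro ⟨x, hx, rfl⟩
        exact ⟨_, ⟨x, hx, rfl⟩, rfl⟩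

/-- The choices needed for the definition of the symmetric simplicial complexity exist. -/
theorem nonempty_approxSystem (K : AbstractSimplicialComplex V) (n : ℕ) :
    Nonempty (power K n).ApproxSystem := by
  refine Classical.nonempty_pi.mpr fun r => ?_
  cases r with
  | zero =>
    let _ : PartialOrder ((power K n).sdIter 0).V := inferInstanceAs (PartialOrder (Fin n → V))
    exact GComplex.nonempty_approxId _ (fun s hs => hs.2.1)
      (fun g _ _ h j => h (perm g j))
  | succ r =>
    let _ : PartialOrder ((power K n).sdIter (r + 1)).V :=
      inferInstanceAs (PartialOrder ((power K n).sdIter r).cx.faces)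
    exact GComplex.nonempty_approxId _ (fun s hs => hs.2)
      (fun g _ _ h => Finset.map_subset_map.mpr h)

/-- `SC^{Σ,r}_n(K)`: the least `k` such that `sd^r(K^n)` is covered by `k` symmetric subcomplexes
on each of which the maps `π_j = p_j ∘ ι^r : sd^r(K^n) → K` are symmetrically contiguous;
`⊤` if there is none.  The family `ι` is the choice of `Σ_n`-approximations of the identity. -/
noncomputable def symSCr (K : AbstractSimplicialComplex V) (n : ℕ)
    (ι : (power K n).ApproxSystem) (r : ℕ) : ℕ∞ :=
  sInf {m : ℕ∞ | ∃ k : ℕ, m = k ∧ ∃ L : Fin k → InvSubcomplex ((power K n).sdIter r),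
    (∀ s ∈ ((power K n).sdIter r).cx.faces, ∃ i, s ∈ (L i).faces) ∧
    ∀ i, SymContiguous (L i).toGComplex K (fun j v => ι.iter r v.1 j)}

/-- `SC^Σ_n(K)`, the minimum of `SC^{Σ,r}_n(K)` over all `r ≥ 0`. -/
noncomputable def symSC (K : AbstractSimplicialComplex V) (n : ℕ)
    (ι : (power K n).ApproxSystem) : ℕ∞ :=
  ⨅ r : ℕ, symSCr K n ι r

end Power

end HigherSym

/-! Both inequalities trade continuous equivariant data on |K|^n for vertex maps on subdivisions of
K^n. No homeomorphism |K^n| ≅ |K|^n is needed.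

`symTC_le_symSCr` holds for every r. Continuous equivariant weights on |K|^n, supported on chains of
simplices of sd^r(K^n), stand in for a map from |K|^n to |sd^{r+1}(K^n)|. A symmetric subcomplex L
determines the open set of points with a nonzero weight on some simplex of L, an open-star
neighbourhood of |L|. Normalising the weights over L and pushing them forward along the contiguity
chain gives maps into |K|^n. Consecutive maps take values in common simplices, and so do the last
map and the inclusion, so straight-line homotopies join them. The first map has equal coordinates,
hence the concatenated homotopy is a family of n paths with common start, which is an equivariant
section of e_n (`hasEquivariantSection_of_symContiguous`).

`symSC_le_symTC` discretises sections. A Lebesgue number replaces the open cover by compact cores,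
on which the motions are uniformly continuous. L_i consists of the simplices of a fine subdivision
with all vertices in the i-th core. At each vertex and each sampled time one chooses a vertex of K
whose barycentric coordinate is at least 1/(|V|+1). The choices over one simplex at two consecutive
times are all nonzero coordinates of a single nearby point, hence span a simplex. One more step
leads from the choices at time 1 to π_j (`symContiguous_of_homotopy`). -/

namespace HigherSym

/-! ### Points of a finite geometric realization. -/

section Points

variable {V : Type u} {K : AbstractSimplicialComplex V}

theorem face_of_subset {s t : Finset V} (hs : s ∈ K.faces) (hts : t ⊆ s) (ht : t.Nonempty) :
    t ∈ K.faces :=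
  (K.isRelLowerSet_faces hs).2 hts ht

theorem face_nonempty {s : Finset V} (hs : s ∈ K.faces) : s.Nonempty :=
  (K.isRelLowerSet_faces hs).1

/-- A convex weight supported on a simplex is a point of the realization. -/
theorem realization_mem [Fintype V] {α : V → ℝ} (h0 : ∀ v, 0 ≤ α v) (h1 : ∑ v, α v = 1)
    {s : Finset V} (hs : s ∈ K.faces) (hα : ∀ v, α v ≠ 0 → v ∈ s) :
    (∀ v, α v ∈ Set.Icc (0 : ℝ) 1) ∧
      ∃ s ∈ K.faces, (∀ v, v ∈ s ↔ α v ≠ 0) ∧ ∑ v ∈ s, α v = 1 := by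
  classical
  have hsum : ∑ v ∈ Finset.univ.filter (fun v => α v ≠ 0), α v = 1 := by
    rw [Finset.sum_filter_ne_zero, h1]
  refine ⟨fun v => ⟨h0 v, ?_⟩, Finset.univ.filter (fun v => α v ≠ 0), ?_, by simp, hsum⟩
  · rw [← h1]
    exact Finset.single_le_sum (fun w _ => h0 w) (Finset.mem_univ v)
  · refine face_of_subset hs (fun v hv => hα v (Finset.mem_filter.mp hv).2) ?_
    by_contra hne
    rw [Finset.not_nonempty_iff_eq_empty.mp hne, Finset.sum_empty] at hsum
    exact zero_ne_one hsum

theorem Realization.nonneg (x : Realization K) (v : V) : 0 ≤ x.1 v := (x.2.1 v).1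

theorem Realization.exists_face (x : Realization K) :
    ∃ s ∈ K.faces, ∀ v, v ∈ s ↔ x.1 v ≠ 0 := by
  obtain ⟨s, hs, h, -⟩ := x.2.2
  exact ⟨s, hs, h⟩

theorem Realization.sum_eq_one [Fintype V] (x : Realization K) : ∑ v, x.1 v = 1 := by
  obtain ⟨s, hs, h, h1⟩ := x.2.2
  refine (Finset.sum_subset (Finset.subset_univ s) fun v _ hv => ?_).symm.trans h1
  by_contra h0
  exact hv ((h v).2 h0)

/-- Pigeonhole on coordinates of total mass 1. The threshold is the same for all points, which makes
the choice of vertices stable under small moves; the +1 avoids division by zero. -/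
theorem Realization.exists_large [Fintype V] (x : Realization K) :
    ∃ v, ((Fintype.card V : ℝ) + 1)⁻¹ ≤ x.1 v := by
  by_contra! h
  have h1 := x.sum_eq_one
  have h2 : ∑ v, x.1 v ≤ ∑ _v : V, ((Fintype.card V : ℝ) + 1)⁻¹ :=
    Finset.sum_le_sum fun v _ => (h v).le
  rw [h1, Finset.sum_const, nsmul_eq_mul, Finset.card_univ, ← div_eq_mul_inv,
    le_div_iff₀ (by positivity)] at h2
  linarith

/-- Relaxing "support equal to s" to "support inside s" writes the realization as a finite union of
closed subsets of the cube. -/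
instance compactSpace_realization [Finite V] : CompactSpace (Realization K) := by
  have := Fintype.ofFinite V
  have key : {α : V → ℝ | (∀ v, α v ∈ Set.Icc (0 : ℝ) 1) ∧
      ∃ s ∈ K.faces, (∀ v, v ∈ s ↔ α v ≠ 0) ∧ ∑ v ∈ s, α v = 1} =
      ⋃ s ∈ K.faces, ((Set.univ.pi fun _ => Set.Icc (0 : ℝ) 1) ∩
        {α : V → ℝ | ∑ v, α v = 1} ∩ ⋂ v ∈ {v | v ∉ s}, {α : V → ℝ | α v = 0}) := by
    ext α
    simp only [Set.mem_iUnion, Set.mem_inter_iff, Set.mem_iInter, Set.mem_ofPred_eq]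
    constructor
    · intro h
      obtain ⟨s, hs, hv⟩ := Realization.exists_face (⟨α, h⟩ : Realization K)
      exact ⟨s, hs, ⟨fun v _ => h.1 v, Realization.sum_eq_one (⟨α, h⟩ : Realization K)⟩,
        fun v hvs => not_not.mp fun h0 => hvs ((hv v).2 h0)⟩
    · rintro ⟨s, hs, ⟨h01, h1⟩, h0⟩
      exact realization_mem (fun v => (h01 v trivial).1) h1 hs
        fun v hv => not_not.mp fun hvs => hv (h0 v hvs)
  refine isCompact_iff_compactSpace.mp ?_
  change IsCompact {α : V → ℝ | _}
  rw [key]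
  refine Set.Finite.isCompact_biUnion (Set.toFinite _) fun s _ => ?_
  refine ((isCompact_univ_pi fun _ => isCompact_Icc).inter_right ?_).inter_right ?_
  · exact isClosed_eq (by fun_prop) continuous_const
  · exact isClosed_biInter fun v _ => isClosed_eq (by fun_prop) continuous_const

end Points

/-! ### Equivariant approximations of the identity. -/

section Approximations

variable {G : Type} [Group G] {M : GComplex.{u} G}

/-- Test the approximation condition at the vertex σ of the subdivision: it is the barycentre of σ,
whose support is exactly σ. -/
theorem GComplex.ApproxId.mem (φ : M.ApproxId) (σ : M.cx.faces) : φ.toFun σ ∈ σ.1 := by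
  classical
  have hmem : ∀ τ : M.cx.faces, τ ∈ ({σ} : Finset M.cx.faces) ↔
      (if τ = σ then (1 : ℝ) else 0) ≠ 0 := by
    intro τ
    by_cases h : τ = σ <;> simp [h]
  let β : Realization (HigherSym.sd M.cx) :=
    ⟨fun τ => if τ = σ then 1 else 0, fun τ => by by_cases h : τ = σ <;> simp [h], {σ},
      (HigherSym.sd M.cx).singleton_mem σ, hmem, by simp⟩
  have hβ : β ∈ openStar (HigherSym.sd M.cx) σ := by
    change (if σ = σ then (1 : ℝ) else 0) ≠ 0
    simp
  have h : baryCoord M.cx β.1 (φ.toFun σ) ≠ 0 := φ.approx σ ⟨β, hβ, rfl⟩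
  rw [baryCoord_eq_sum M.cx β.1 {σ} hmem, Finset.sum_singleton] at h
  by_contra hn
  exact h (by rw [if_neg hn, mul_zero])

theorem GComplex.ApproxSystem.iter_smul (ι : M.ApproxSystem) (r : ℕ) (g : G)
    (v : (M.sdIter r).V) : ι.iter r (g • v) = g • ι.iter r v := by
  induction r with
  | zero => rfl
  | succ r ih =>
    change ι.iter r ((ι r).toFun (g • v)) = g • ι.iter r ((ι r).toFun v)
    rw [← ih]
    exact congrArg _ ((ι r).equivariant g v)

theorem finite_sdIter [Finite M.V] (r : ℕ) : Finite (M.sdIter r).V := by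
  induction r with
  | zero => assumption
  | succ r ih => exact inferInstanceAs (Finite (M.sdIter r).cx.faces)

/-- The vertices of a simplex, seen as a vertex of the barycentric subdivision. -/
def GComplex.verts {M : GComplex.{u} G} (σ : M.sd.V) : Finset M.V :=
  Subtype.val (p := (· ∈ M.cx.faces)) σ

theorem GComplex.smul_mem_verts (g : G) (v : M.V) (σ : M.sd.V) :
    g • v ∈ GComplex.verts (g • σ) ↔ v ∈ GComplex.verts σ := by
  change g • v ∈ (GComplex.verts σ).map (MulAction.toPerm g).toEmbedding ↔ _
  simp

theorem GComplex.verts_smul (g : G) (σ : M.sd.V) :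
    GComplex.verts (g • σ) = (GComplex.verts σ).map (MulAction.toPerm g).toEmbedding :=
  rfl

theorem GComplex.verts_mem (σ : M.sd.V) : GComplex.verts σ ∈ M.cx.faces :=
  Subtype.property (p := (· ∈ M.cx.faces)) σ

end Approximations

/-! ### Equivariant weights and their subdivision. -/

section Weights

variable {G : Type} [Group G] {X : Type u} [TopologicalSpace X] [SMul G X]

/-- Continuous equivariant systems of nonnegative weights on the vertices of `M`, the weights at
each point being supported on a simplex: up to normalisation, equivariant maps `X → |M|`. -/
structure IsWeight (M : GComplex.{u} G) (b : X → M.V → ℝ) : Prop where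
  continuous : ∀ v, Continuous fun x => b x v
  nonneg : ∀ x v, 0 ≤ b x v
  support : ∀ x, ∃ s ∈ M.cx.faces, ∀ v, v ∈ s ↔ b x v ≠ 0
  equivariant : ∀ (g : G) x v, b (g • x) (g • v) = b x v

/-- The new weight of σ is nonzero exactly when σ is a strict superlevel set of b inside its
support: every value on σ exceeds every value off σ. Such sets are nested, so they form a chain, and
the whole support is one of them. Products of positive parts make this continuous. -/
theorem IsWeight.exists_sd {M : GComplex.{u} G} [Finite M.V] {b : X → M.V → ℝ}
    (hb : IsWeight M b) : ∃ b' : X → M.sd.V → ℝ, IsWeight M.sd b' ∧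
      ∀ x σ, b' x σ ≠ 0 → ∀ v ∈ GComplex.verts σ, b x v ≠ 0 := by
  classical
  have := Fintype.ofFinite M.V
  let d : X → M.V → M.V → ℝ := fun x v u => max 0 (b x v - b x u)
  let b' : X → M.sd.V → ℝ := fun x σ =>
    (∏ v ∈ GComplex.verts σ, b x v) *
      ∏ v ∈ GComplex.verts σ, ∏ u, if u ∈ GComplex.verts σ then 1 else d x v u
  have hd : ∀ x v u, 0 ≤ d x v u := fun x v u => le_max_left _ _
  have hne : ∀ x σ, b' x σ ≠ 0 ↔ (∀ v ∈ GComplex.verts σ, b x v ≠ 0) ∧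
      ∀ v ∈ GComplex.verts σ, ∀ u ∉ GComplex.verts σ, b x u < b x v := by
    intro x σ
    simp only [b', mul_ne_zero_iff, Finset.prod_ne_zero_iff]
    refine and_congr Iff.rfl (forall₂_congr fun v _ => ?_)
    refine ⟨fun h u hu => ?_, fun h u _ => ?_⟩
    · have h1 := h u (Finset.mem_univ u)
      rw [if_neg hu] at h1
      by_contra hlt
      exact h1 (max_eq_left (by linarith))
    · split_ifs with hu
      · exact one_ne_zero
      · exact (lt_max_of_lt_right (sub_pos.mpr (h u hu))).ne'
  refine ⟨b', ⟨?_, ?_, ?_, ?_⟩, fun x σ h => ((hne x σ).1 h).1⟩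
  · intro σ
    refine (continuous_finsetProd _ fun v _ => hb.continuous v).mul
      (continuous_finsetProd _ fun v _ => continuous_finsetProd _ fun u _ => ?_)
    split_ifs
    · exact continuous_const
    · exact continuous_const.max ((hb.continuous v).sub (hb.continuous u))
  · intro x σ
    refine mul_nonneg (Finset.prod_nonneg fun v _ => hb.nonneg x v)
      (Finset.prod_nonneg fun v _ => Finset.prod_nonneg fun u _ => ?_)
    split_ifs
    · exact zero_le_one
    · exact hd x v u
  · intro x
    obtain ⟨s, hs, hsupp⟩ := hb.support x
    let c : Finset M.cx.faces := (Set.toFinite {σ : M.cx.faces | b' x σ ≠ 0}).toFinset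
    have hc : ∀ σ, σ ∈ c ↔ b' x σ ≠ 0 := fun σ => Set.Finite.mem_toFinset _
    refine ⟨c, ⟨⟨⟨s, hs⟩, ?_⟩, ?_⟩, hc⟩
    · refine (hc _).2 ((hne x _).2 ⟨fun v hv => (hsupp v).1 hv, ?_⟩)
      intro v hv u hu
      have hu0 : b x u = 0 := not_not.mp fun h => hu ((hsupp u).2 h)
      rw [hu0]
      exact lt_of_le_of_ne (hb.nonneg x v) ((hsupp v).1 hv).symm
    · intro σ hσ τ hτ _
      have hσ' := (hne x σ).1 ((hc σ).1 hσ)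
      have hτ' := (hne x τ).1 ((hc τ).1 hτ)
      by_contra hcon
      rw [not_or] at hcon
      obtain ⟨v, hv, hv'⟩ := Finset.not_subset.mp (fun h => hcon.1 h :
        ¬ GComplex.verts σ ⊆ GComplex.verts τ)
      obtain ⟨u, hu, hu'⟩ := Finset.not_subset.mp (fun h => hcon.2 h :
        ¬ GComplex.verts τ ⊆ GComplex.verts σ)
      exact lt_asymm (hσ'.2 v hv u hu') (hτ'.2 u hu v hv')
  · intro g x σ
    have hd' : ∀ v u, d (g • x) (g • v) (g • u) = d x v u := fun v u => by
      simp only [d, hb.equivariant]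
    simp only [b']
    rw [GComplex.verts_smul, Finset.prod_map, Finset.prod_map]
    refine congrArg₂ _ (Finset.prod_congr rfl fun v _ => hb.equivariant g x v)
      (Finset.prod_congr rfl fun v _ => ?_)
    rw [← Equiv.prod_comp (MulAction.toPerm g)]
    refine Finset.prod_congr rfl fun u _ => ?_
    refine if_congr ?_ rfl (hd' v u)
    rw [← GComplex.verts_smul]
    exact GComplex.smul_mem_verts g u σ

theorem IsWeight.exists_sdIter {M : GComplex.{u} G} [Finite M.V] (ι : M.ApproxSystem)
    {b : X → M.V → ℝ} (hb : IsWeight M b) (r : ℕ) :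
    ∃ b' : X → (M.sdIter r).V → ℝ, IsWeight (M.sdIter r) b' ∧
      ∀ x v, b' x v ≠ 0 → b x (ι.iter r v) ≠ 0 := by
  induction r with
  | zero => exact ⟨b, hb, fun _ _ h => h⟩
  | succ r ih =>
    obtain ⟨b₁, hb₁, h₁⟩ := ih
    have := finite_sdIter (M := M) r
    obtain ⟨b₂, hb₂, h₂⟩ := hb₁.exists_sd
    exact ⟨b₂, hb₂, fun x σ hσ => h₁ x _ (h₂ x σ hσ _ ((ι r).mem σ))⟩

end Weights

/-! ### Weights on the product complex. -/

section PowerWeights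

variable {V : Type u} [PartialOrder V] {K : AbstractSimplicialComplex V}

/-- This is the staircase triangulation of a product. Each x_j cuts [0,1] into intervals (E(v),
F(v)) of length x_j(v), ordered along the simplex. A tuple w gets a nonzero weight exactly when the
intervals of its entries overlap, that is, when each left end lies before each right end. The tuples
met in this way form a chain. -/
theorem exists_isWeight_power [Finite V] (hK : IsOrderedComplex K) (n : ℕ) :
    ∃ b : (Fin n → Realization K) → (power K n).V → ℝ, IsWeight (power K n) b ∧
      ∀ x v, b x v ≠ 0 → ∀ j, (x j).1 (v j) ≠ 0 := by
  classical
  have := Fintype.ofFinite V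
  let F : Realization K → V → ℝ := fun x v => ∑ u, if u ≤ v then x.1 u else 0
  let E : Realization K → V → ℝ := fun x v => ∑ u, if u < v then x.1 u else 0
  have hFE : ∀ x v, F x v = E x v + x.1 v := by
    intro x v
    have : x.1 v = ∑ u, if u = v then x.1 u else 0 := by simp
    rw [this, ← Finset.sum_add_distrib]
    refine Finset.sum_congr rfl fun u _ => ?_
    by_cases h : u = v
    · simp [h]
    · simp [h, le_iff_lt_or_eq]
  have hmono : ∀ (x : Realization K) {u v : V}, u < v → F x u ≤ E x v := by
    intro x u v huv
    refine Finset.sum_le_sum fun w _ => ?_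
    by_cases h : w ≤ u
    · rw [if_pos h, if_pos (h.trans_lt huv)]
    · rw [if_neg h]
      split_ifs
      · exact x.nonneg w
      · exact le_rfl
  have hcoord : ∀ v, Continuous fun x : Realization K => x.1 v := fun v =>
    (continuous_apply v).comp continuous_subtype_val
  have hFc : ∀ v, Continuous fun x => F x v := fun v =>
    continuous_finsetSum _ fun u _ => by
      split_ifs
      · exact hcoord u
      · exact continuous_const
  have hEc : ∀ v, Continuous fun x => E x v := fun v =>
    continuous_finsetSum _ fun u _ => by
      split_ifs
      · exact hcoord u
      · exact continuous_const
  let b : (Fin n → Realization K) → (Fin n → V) → ℝ := fun x w =>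
    ∏ j, ∏ k, max 0 (F (x j) (w j) - E (x k) (w k))
  have hne : ∀ x w, b x w ≠ 0 ↔ ∀ j k, E (x k) (w k) < F (x j) (w j) := by
    intro x w
    simp only [b, Finset.prod_ne_zero_iff]
    refine ⟨fun h j k => ?_, fun h j _ k _ => ?_⟩
    · by_contra hlt
      exact h j (Finset.mem_univ j) k (Finset.mem_univ k) (max_eq_left (by linarith))
    · exact (lt_max_of_lt_right (sub_pos.mpr (h j k))).ne'
  have hsupp : ∀ x w, b x w ≠ 0 → ∀ j, (x j).1 (w j) ≠ 0 := by
    intro x w h j h0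
    have h1 := (hne x w).1 h j j
    rw [hFE, h0] at h1
    linarith
  refine ⟨b, ⟨?_, ?_, ?_, ?_⟩, hsupp⟩
  · intro w
    exact continuous_finsetProd _ fun j _ => continuous_finsetProd _ fun k _ =>
      continuous_const.max (((hFc (w j)).comp (continuous_apply j)).sub
        ((hEc (w k)).comp (continuous_apply k)))
  · exact fun x w => Finset.prod_nonneg fun j _ => Finset.prod_nonneg fun k _ => le_max_left _ _
  · intro x
    choose s hs hsx using fun j => (x j).exists_face
    have htop : ∀ j, ∃ m ∈ s j, ∀ u ∈ s j, u ≤ m := fun j =>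
      exists_greatest (s j) (face_nonempty (hs j)) (hK (s j) (hs j))
    choose m hm hmax using htop
    have hFm : ∀ j, F (x j) (m j) = 1 := by
      intro j
      rw [← (x j).sum_eq_one]
      refine Finset.sum_congr rfl fun u _ => ?_
      split_ifs with h
      · rfl
      · exact (not_not.mp fun h0 => h (hmax j u ((hsx j u).2 h0))).symm
    let c : Finset (Fin n → V) := Finset.univ.filter fun w => b x w ≠ 0
    have hc : ∀ w, w ∈ c ↔ b x w ≠ 0 := fun w => by simp [c]
    have hcne : c.Nonempty := by
      -- The tuple of greatest vertices always occurs: all its intervals end at 1 and have positive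
      -- length.
      refine ⟨m, (hc m).2 ((hne x m).2 fun j k => ?_)⟩
      have h1 := hFE (x k) (m k)
      have h2 := lt_of_le_of_ne ((x k).nonneg (m k)) ((hsx k _).1 (hm k)).symm
      rw [hFm] at h1 ⊢
      linarith
    refine ⟨c, ⟨hcne, ?_, fun j => ?_⟩, hc⟩
    · intro w hw w' hw' _
      have hw1 := (hc w).1 hw
      have hw1' := (hc w').1 hw'
      by_contra hcon
      rw [not_or] at hcon
      obtain ⟨j, hj⟩ := not_forall.mp (fun h => hcon.1 h : ¬ ∀ j, w j ≤ w' j)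
      obtain ⟨k, hk⟩ := not_forall.mp (fun h => hcon.2 h : ¬ ∀ k, w' k ≤ w k)
      have total : ∀ i, w i ≤ w' i ∨ w' i ≤ w i := fun i =>
        (hK (s i) (hs i)).total ((hsx i _).2 (hsupp x w hw1 i)) ((hsx i _).2 (hsupp x w' hw1' i))
      have hj' : w' j < w j := lt_of_le_not_ge ((total j).resolve_left hj) hj
      have hk' : w k < w' k := lt_of_le_not_ge ((total k).resolve_right hk) hk
      -- If w' is below w at j and above it at k, then E_j(w) < F_k(w) ≤ E_k(w') < F_j(w') ≤ E_j(w),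
      -- which is absurd.
      have h1 := (hne x w).1 hw1 k j
      have h2 := (hne x w').1 hw1' j k
      have h3 := hmono (x j) hj'
      have h4 := hmono (x k) hk'
      linarith
    · refine face_of_subset (hs j) (fun v hv => ?_) (hcne.image _)
      obtain ⟨w, hw, rfl⟩ := Finset.mem_image.mp hv
      exact (hsx j _).2 (hsupp x w ((hc w).1 hw) j)
  · intro g x w
    change ∏ j, ∏ k, max 0 (F (x (perm g j)) (w (perm g j)) - E (x (perm g k)) (w (perm g k))) =
      ∏ j, ∏ k, max 0 (F (x j) (w j) - E (x k) (w k))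
    rw [Equiv.prod_comp (perm g) fun j =>
      ∏ k, max 0 (F (x j) (w j) - E (x (perm g k)) (w (perm g k)))]
    exact Finset.prod_congr rfl fun j _ =>
      Equiv.prod_comp (perm g) fun k => max 0 (F (x j) (w j) - E (x k) (w k))

end PowerWeights

/-! ### Families of paths as maps from the wedge. -/

section WedgeMaps

variable {n : ℕ}

/-- The saturation of a closed set is either itself or its union with the closed set of points at
parameter 0, and the fibres are compact. Properness survives products with an arbitrary space, which
a mere quotient map need not. -/
theorem isProperMap_wedge_mk :
    IsProperMap (Quotient.mk (wedgeSetoid n) : unitInterval × Fin n → Wedge n) := by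
  have hmk : ∀ a b : unitInterval × Fin n,
      (Quotient.mk (wedgeSetoid n) a = Quotient.mk (wedgeSetoid n) b) ↔
        (a = b ∨ (a.1 = 0 ∧ b.1 = 0)) := fun a b => Quotient.eq
  have hzero : IsClosed {a : unitInterval × Fin n | a.1 = 0} :=
    isClosed_eq continuous_fst continuous_const
  rw [isProperMap_iff_isClosedMap_and_compact_fibers]
  refine ⟨continuous_quot_mk, fun C hC => ?_, fun w => ?_⟩
  · refine (isQuotientMap_quot_mk (X := unitInterval × Fin n)).isClosed_preimage.mp ?_
    by_cases h : ∃ a ∈ C, a.1 = 0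
    · obtain ⟨a, ha, ha0⟩ := h
      convert hC.union hzero using 1
      ext b
      constructor
      · rintro ⟨c, hc, hcb⟩
        rcases (hmk c b).1 hcb with rfl | hcb
        · exact Or.inl hc
        · exact Or.inr hcb.2
      · rintro (hb | hb)
        · exact ⟨b, hb, rfl⟩
        · exact ⟨a, ha, (hmk a b).2 (Or.inr ⟨ha0, hb⟩)⟩
    · convert hC using 1
      ext b
      constructor
      · rintro ⟨c, hc, hcb⟩
        rcases (hmk c b).1 hcb with rfl | hcb
        · exact hc
        · exact absurd ⟨c, hc, hcb.1⟩ h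
      · exact fun hb => ⟨b, hb, rfl⟩
  · induction w using Quotient.inductionOn with
    | _ a =>
    refine IsClosed.isCompact ?_
    by_cases ha : a.1 = 0
    · convert hzero using 1
      ext b
      refine (hmk b a).trans ⟨?_, fun hb => Or.inr ⟨hb, ha⟩⟩
      rintro (rfl | hb)
      · exact ha
      · exact hb.1
    · convert isClosed_singleton (x := a) using 1
      ext b
      exact (hmk b a).trans (or_iff_left fun hb => ha hb.2)

/-- A family of `n`-tuples of paths with common starting points is a map into `X^{I_n}`. -/
theorem exists_wedge_lift {X Y : Type u} [TopologicalSpace X] [TopologicalSpace Y]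
    (H : Y → unitInterval → Fin n → X) (hH : ∀ j, Continuous fun p : Y × unitInterval => H p.1 p.2 j)
    (h0 : ∀ y i j, H y 0 i = H y 0 j) :
    ∃ s : Y → C(Wedge n, X), Continuous s ∧ ∀ y t j, s y (Wedge.pt t j) = H y t j := by
  let h : Y × Wedge n → X := fun p => Quotient.lift
    (fun a : unitInterval × Fin n => H p.1 a.1 a.2) (by
      rintro ⟨t, i⟩ ⟨t', j⟩ (hab | ⟨ha, hb⟩)
      · rw [hab]
      · change t = 0 at ha
        change t' = 0 at hb
        subst ha hb
        exact h0 p.1 i j) p.2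
  -- Properness gives a closed surjection here without any local compactness of Y.
  have hq : Topology.IsQuotientMap
      (Prod.map (id : Y → Y) (Quotient.mk (wedgeSetoid n) : unitInterval × Fin n → Wedge n)) := by
    have hp := isProperMap_id.prodMap (f := (id : Y → Y)) (isProperMap_wedge_mk (n := n))
    exact hp.isClosedMap.isQuotientMap hp.continuous
      (Function.surjective_id.prodMap Quotient.mk_surjective)
  have hc : Continuous h := by
    refine hq.continuous_iff.mpr ?_
    change Continuous fun p : Y × (unitInterval × Fin n) => H p.1 p.2.1 p.2.2
    have : Continuous fun p : (Y × unitInterval) × Fin n => H p.1.1 p.1.2 p.2 :=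
      continuous_prod_of_discrete_right.mpr hH
    exact this.comp (Homeomorph.prodAssoc Y unitInterval (Fin n)).symm.continuous
  exact ⟨ContinuousMap.curry ⟨h, hc⟩, (ContinuousMap.curry ⟨h, hc⟩).continuous, fun y t j => rfl⟩

/-- The equivariance of a map defined on a subset of a power. -/
def EquivariantOn {X : Type u} [TopologicalSpace X] (U : Set (Fin n → X))
    (f : C(U, Fin n → X)) : Prop :=
  ∀ (g : Sym n) (x y : U), (y : Fin n → X) = g • (x : Fin n → X) → f y = g • f x

/-- Read at a fixed point, the homotopy is n paths with a common start, and its end is the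
evaluation. Equivariance at every time is equivariance of the resulting section. -/
theorem hasEquivariantSection_of_homotopic {X : Type u} [TopologicalSpace X]
    {U : Set (Fin n → X)} {f : C(U, Fin n → X)} (hf : ∀ x i j, f x i = f x j)
    (h : ContinuousMap.HomotopicWith f ⟨Subtype.val, continuous_subtype_val⟩ (EquivariantOn U)) :
    HasEquivariantSection (Sym n) (evalEnds n X) U := by
  obtain ⟨H⟩ := h
  obtain ⟨s, hs, hsH⟩ := exists_wedge_lift (fun x t j => H (t, x) j)
    (fun j => (continuous_apply j).comp (H.continuous.comp continuous_swap))
    (fun x i j => by rw [H.apply_zero]; exact hf x i j)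
  refine ⟨s, hs, fun x => funext fun j => ?_, fun g x y hxy => ContinuousMap.ext fun w => ?_⟩
  · change s x (Wedge.pt 1 j) = _
    rw [hsH, H.apply_one]
    rfl
  · induction w using Quotient.inductionOn with
    | _ a =>
    change s y (Wedge.pt a.1 a.2) = s x (Wedge.pt a.1 (perm g a.2))
    rw [hsH, hsH]
    exact congrFun (H.prop a.1 g x y hxy) a.2

end WedgeMaps

/-! ### Straight-line homotopies. -/

section LinearHomotopies

variable {V : Type u} [Finite V] {K : AbstractSimplicialComplex V} {n : ℕ}

/-- Maps into `|K|` whose values lie in common simplices are homotopic. -/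
theorem homotopicWith_of_contiguous {U : Set (Fin n → Realization K)}
    {f₀ f₁ : C(U, Fin n → Realization K)}
    (h₀ : EquivariantOn U f₀) (h₁ : EquivariantOn U f₁)
    (h : ∀ x j, ∃ s ∈ K.faces, ∀ v, (f₀ x j).1 v ≠ 0 ∨ (f₁ x j).1 v ≠ 0 → v ∈ s) :
    ContinuousMap.HomotopicWith f₀ f₁ (EquivariantOn U) := by
  have := Fintype.ofFinite V
  let F : unitInterval × U → Fin n → V → ℝ := fun p j v =>
    (1 - (p.1 : ℝ)) * (f₀ p.2 j).1 v + p.1 * (f₁ p.2 j).1 v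
  have hF : ∀ p j, (∀ v, F p j v ∈ Set.Icc (0 : ℝ) 1) ∧
      ∃ s ∈ K.faces, (∀ v, v ∈ s ↔ F p j v ≠ 0) ∧ ∑ v ∈ s, F p j v = 1 := by
    intro p j
    obtain ⟨s, hs, hv⟩ := h p.2 j
    refine realization_mem (fun v => ?_) ?_ hs fun v hne => hv v ?_
    · exact add_nonneg (mul_nonneg (sub_nonneg.mpr p.1.2.2) (Realization.nonneg _ _))
        (mul_nonneg p.1.2.1 (Realization.nonneg _ _))
    · simp only [F]
      rw [Finset.sum_add_distrib, ← Finset.mul_sum, ← Finset.mul_sum, Realization.sum_eq_one,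
        Realization.sum_eq_one]
      ring
    · by_contra hcon
      rw [not_or, not_not, not_not] at hcon
      exact hne (by simp only [F]; rw [hcon.1, hcon.2]; ring)
  have hval : ∀ f : C(U, Fin n → Realization K), ∀ j v,
      Continuous fun p : unitInterval × U => (f p.2 j).1 v := fun f j v =>
    (continuous_apply v).comp (continuous_subtype_val.comp ((continuous_apply j).comp
      (f.continuous.comp continuous_snd)))
  have hcont : Continuous fun p j => (⟨F p j, hF p j⟩ : Realization K) := by
    refine continuous_pi fun j => Continuous.subtype_mk (continuous_pi fun v => ?_) _
    have ht : Continuous fun p : unitInterval × U => (p.1 : ℝ) :=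
      continuous_subtype_val.comp continuous_fst
    exact ((continuous_const.sub ht).mul (hval f₀ j v)).add (ht.mul (hval f₁ j v))
  refine ⟨⟨⟨⟨_, hcont⟩, fun x => ?_, fun x => ?_⟩, fun t g x y hxy => ?_⟩⟩
  · funext j
    refine Subtype.ext (funext fun v => ?_)
    simp [F]
  · funext j
    refine Subtype.ext (funext fun v => ?_)
    simp [F]
  · funext j
    refine Subtype.ext (funext fun v => ?_)
    change F (t, y) j v = F (t, x) (perm g j) v
    simp only [F]
    rw [h₀ g x y hxy, h₁ g x y hxy]
    rfl

end LinearHomotopies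

/-! ### From symmetric contiguity to sections. -/

section SectionsFromContiguity

variable {V : Type u} {K : AbstractSimplicialComplex V} {n : ℕ}

theorem InvSubcomplex.exists_face {G : Type} [Group G] {M : GComplex.{u} G} (L : InvSubcomplex M)
    {s : Finset M.V} (hs : s ∈ L.faces) :
    ∃ t ∈ L.toGComplex.cx.faces, ∀ v : L.toGComplex.V,
      v ∈ t ↔ (show {v : M.V // ({v} : Finset M.V) ∈ L.faces} from v).1 ∈ s := by
  classical
  refine ⟨s.subtype fun v => ({v} : Finset M.V) ∈ L.faces, ?_, fun v => Finset.mem_subtype⟩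
  change (s.subtype fun v => ({v} : Finset M.V) ∈ L.faces).map (Function.Embedding.subtype _) ∈ L.faces
  rw [Finset.subtype_map_of_mem fun v hv => (L.isRelLowerSet_faces hs).2
    (Finset.singleton_subset_iff.mpr hv) (Finset.singleton_nonempty v)]
  exact hs

/-- A system of weights on `A` and vertex maps `A → V` define a map to a power of `|K|`. -/
theorem exists_push [Finite V] {A : Type u} [Fintype A] {U : Set (Fin n → Realization K)}
    (a : U → A → ℝ) (ha : ∀ σ, Continuous fun x => a x σ) (ha0 : ∀ x σ, 0 ≤ a x σ)
    (hane : ∀ x, ∃ σ, a x σ ≠ 0) (e : Sym n → Equiv.Perm A)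
    (hae : ∀ (g : Sym n) (x y : U), (y : Fin n → Realization K) = g • (x : Fin n → Realization K) →
      ∀ σ, a y (e g σ) = a x σ)
    (f : Fin n → A → V) (hfe : ∀ j g σ, f j (e g σ) = f (perm g j) σ)
    (hface : ∀ x j, ∃ s ∈ K.faces, ∀ σ, a x σ ≠ 0 → f j σ ∈ s) :
    ∃ Z : C(U, Fin n → Realization K), EquivariantOn U Z ∧
      (∀ x i j, f i = f j → Z x i = Z x j) ∧
      ∀ x j w, (Z x j).1 w ≠ 0 → ∃ σ, a x σ ≠ 0 ∧ f j σ = w := by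
  classical
  have := Fintype.ofFinite V
  -- Push-forward of the normalised weights. It depends on j only through the vertex map, so equal
  -- vertex maps give equal coordinates.
  let z : U → (A → V) → V → ℝ := fun x f w => (∑ σ, if f σ = w then a x σ else 0) / ∑ σ, a x σ
  have hpos : ∀ x, 0 < ∑ σ, a x σ := by
    intro x
    obtain ⟨σ, hσ⟩ := hane x
    exact Finset.sum_pos' (fun τ _ => ha0 x τ)
      ⟨σ, Finset.mem_univ σ, lt_of_le_of_ne (ha0 x σ) hσ.symm⟩
  have hne : ∀ x f w, z x f w ≠ 0 → ∃ σ, a x σ ≠ 0 ∧ f σ = w := by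
    intro x f w h
    by_contra! hcon
    refine h ?_
    simp only [z]
    rw [Finset.sum_eq_zero, zero_div]
    intro σ _
    split_ifs with hσ
    · by_contra h0
      exact hcon σ h0 hσ
    · rfl
  have hz : ∀ x j, (∀ v, z x (f j) v ∈ Set.Icc (0 : ℝ) 1) ∧
      ∃ s ∈ K.faces, (∀ v, v ∈ s ↔ z x (f j) v ≠ 0) ∧ ∑ v ∈ s, z x (f j) v = 1 := by
    intro x j
    obtain ⟨s, hs, hsf⟩ := hface x j
    refine realization_mem (fun v => ?_) ?_ hs fun v hv => ?_
    · refine div_nonneg (Finset.sum_nonneg fun σ _ => ?_) (hpos x).le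
      split_ifs
      · exact ha0 x σ
      · exact le_rfl
    · simp only [z]
      rw [← Finset.sum_div, Finset.sum_comm]
      simp only [Finset.sum_ite_eq, Finset.mem_univ, if_true]
      exact div_self (hpos x).ne'
    · obtain ⟨σ, hσ, rfl⟩ := hne x _ v hv
      exact hsf σ hσ
  have hcont : Continuous fun x j => (⟨z x (f j), hz x j⟩ : Realization K) := by
    refine continuous_pi fun j => Continuous.subtype_mk (continuous_pi fun v => ?_) _
    refine (continuous_finsetSum _ fun σ _ => ?_).div (continuous_finsetSum _ fun σ _ => ha σ)
      fun x => (hpos x).ne'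
    split_ifs
    · exact ha σ
    · exact continuous_const
  refine ⟨⟨_, hcont⟩, fun g x y hxy => ?_, fun x i j hij => Subtype.ext (congrArg (z x) hij),
    fun x j w => hne x (f j) w⟩
  funext j
  refine Subtype.ext (funext fun w => ?_)
  change z y (f j) w = z x (f (perm g j)) w
  simp only [z]
  rw [← Equiv.sum_comp (e g) (a y), ← Equiv.sum_comp (e g)]
  simp only [hae g x y hxy, hfe]

/-- On the open-star neighbourhood of L, discarding the weights off L and renormalising acts as a
retraction to |L|, after which the contiguity chain is realised by linear homotopies. -/
theorem hasEquivariantSection_of_symContiguous [Finite V] (M : GComplex.{u} (Sym n)) [Finite M.V]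
    (φ : M.ApproxId) (L : InvSubcomplex M) (p : Fin n → M.V → V)
    {b : (Fin n → Realization K) → M.sd.V → ℝ} (hb : IsWeight M.sd b)
    (hbp : ∀ x σ, b x σ ≠ 0 → ∀ j, (x j).1 (p j (φ.toFun σ)) ≠ 0)
    (hL : SymContiguous L.toGComplex K fun j v => p j v.1) :
    HasEquivariantSection (Sym n) (evalEnds n (Realization K))
      {x | ∃ σ : M.sd.V, GComplex.verts σ ∈ L.faces ∧ b x σ ≠ 0} := by
  classical
  obtain ⟨-, -, φstar, c, ψ, -, hstar, -, hψ0, hψc, hψs, hψ1, hψe⟩ := hL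
  set U : Set (Fin n → Realization K) :=
    {x | ∃ σ : M.sd.V, GComplex.verts σ ∈ L.faces ∧ b x σ ≠ 0} with hU
  let A : Type u := {σ : M.sd.V // GComplex.verts σ ∈ L.faces}
  have : Finite M.sd.V := inferInstanceAs (Finite M.cx.faces)
  have : Fintype A := Fintype.ofFinite A
  let a : U → A → ℝ := fun x σ => b x.1 σ.1
  have hmem : ∀ g : Sym n, ∀ σ : M.sd.V,
      GComplex.verts (MulAction.toPerm g σ) ∈ L.faces ↔ GComplex.verts σ ∈ L.faces := by
    intro g σ
    refine ⟨fun h => ?_, fun h => L.invariant g _ h⟩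
    have h1 := L.invariant g⁻¹ _ h
    rw [← GComplex.verts_smul] at h1
    rwa [MulAction.toPerm_apply, inv_smul_smul] at h1
  let e : Sym n → Equiv.Perm A := fun g => (MulAction.toPerm g).subtypePerm (hmem g)
  let q : A → L.toGComplex.V := fun σ => ⟨φ.toFun σ.1, (L.isRelLowerSet_faces σ.2).2
    (Finset.singleton_subset_iff.mpr (φ.mem σ.1)) (Finset.singleton_nonempty _)⟩
  have hqe : ∀ g σ, q (e g σ) = g • q σ := fun g σ => Subtype.ext (φ.equivariant g σ.1)
  have hae : ∀ (g : Sym n) (x y : U),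
      (y : Fin n → Realization K) = g • (x : Fin n → Realization K) →
      ∀ σ, a y (e g σ) = a x σ := by
    intro g x y hxy σ
    change b y.1 (g • σ.1) = b x.1 σ.1
    rw [hxy, hb.equivariant]
  -- The simplices of L carrying weight at x form a chain. Its greatest member contains the vertices
  -- chosen from all the others.
  have hcarrier : ∀ x : U, ∃ t ∈ L.toGComplex.cx.faces, ∀ σ, a x σ ≠ 0 → q σ ∈ t := by
    intro x
    obtain ⟨d, ⟨-, hd⟩, hdb⟩ := hb.support x.1
    let d' : Finset M.cx.faces := d.filter fun σ => GComplex.verts σ ∈ L.faces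
    have hd' : d'.Nonempty := by
      obtain ⟨σ, hσ, hσb⟩ := x.2
      exact ⟨σ, Finset.mem_filter.mpr ⟨(hdb σ).2 hσb, hσ⟩⟩
    obtain ⟨τ, hτ, hmax⟩ := exists_greatest d' hd'
      (hd.mono (Finset.coe_subset.mpr (Finset.filter_subset _ _)))
    obtain ⟨t, ht, htv⟩ := L.exists_face (Finset.mem_filter.mp hτ).2
    exact ⟨t, ht, fun σ hσ => (htv (q σ)).2
      (hmax σ.1 (Finset.mem_filter.mpr ⟨(hdb σ.1).2 hσ, σ.2⟩) (φ.mem σ.1))⟩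
  have hex : ∀ l, l ≤ c → ∃ Z : C(U, Fin n → Realization K), EquivariantOn U Z ∧
      (∀ x i j, ψ i l ∘ q = ψ j l ∘ q → Z x i = Z x j) ∧
      ∀ x j w, (Z x j).1 w ≠ 0 → ∃ σ, a x σ ≠ 0 ∧ ψ j l (q σ) = w := by
    intro l hl
    refine exists_push a (fun σ => (hb.continuous σ.1).comp continuous_subtype_val)
      (fun x σ => hb.nonneg x.1 σ.1) ?_ e hae (fun j => ψ j l ∘ q) ?_ ?_
    · rintro ⟨x, σ, hσ, hσb⟩
      exact ⟨⟨σ, hσ⟩, hσb⟩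
    · intro j g σ
      change ψ j l (q (e g σ)) = ψ (perm g j) l (q σ)
      rw [hqe]
      -- The equivariance of the chain is given only for l ≥ 1; at l = 0 it comes from the
      -- invariance of the common start.
      rcases Nat.eq_zero_or_pos l with rfl | hl0
      · rw [hψ0, hψ0]
        exact hstar g (q σ)
      · exact hψe j l hl0 hl g (q σ)
    · intro x j
      obtain ⟨t, ht, htσ⟩ := hcarrier x
      exact ⟨_, hψs j l hl t ht, fun σ hσ => Finset.mem_image_of_mem _ (htσ σ hσ)⟩
  choose Z hZe hZeq hZ using hex
  have hchain : ∀ l (hl : l ≤ c),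
      ContinuousMap.HomotopicWith (Z 0 (Nat.zero_le c)) (Z l hl) (EquivariantOn U) := by
    intro l
    induction l with
    | zero => exact fun _ => ContinuousMap.HomotopicWith.refl _ (hZe 0 _)
    | succ l ih =>
      intro hl
      refine (ih (by omega)).trans (homotopicWith_of_contiguous (hZe _ _) (hZe _ _) ?_)
      intro x j
      obtain ⟨t, ht, htσ⟩ := hcarrier x
      refine ⟨_, hψ1 j l hl t ht, fun v hv => ?_⟩
      rw [Finset.mem_union]
      rcases hv with hv | hv
      · obtain ⟨σ, hσ, rfl⟩ := hZ _ _ x j v hv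
        exact Or.inl (Finset.mem_image_of_mem _ (htσ σ hσ))
      · obtain ⟨σ, hσ, rfl⟩ := hZ _ _ x j v hv
        exact Or.inr (Finset.mem_image_of_mem _ (htσ σ hσ))
  refine hasEquivariantSection_of_homotopic (f := Z 0 (Nat.zero_le c))
    (fun x i j => hZeq 0 _ x i j (by rw [hψ0, hψ0]))
    ((hchain c le_rfl).trans (homotopicWith_of_contiguous (hZe _ _) (fun g x y hxy => hxy) ?_))
  intro x j
  obtain ⟨s, hs, hsx⟩ := (x.1 j).exists_face
  refine ⟨s, hs, fun v hv => (hsx v).2 ?_⟩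
  rcases hv with hv | hv
  · obtain ⟨σ, hσ, rfl⟩ := hZ _ _ x j v hv
    rw [hψc]
    exact hbp x.1 σ.1 hσ j
  · exact hv

theorem symTC_le_symSCr [Finite V] [PartialOrder V] (hK : IsOrderedComplex K)
    (ι : (power K n).ApproxSystem) (r : ℕ) :
    symTC n (Realization K) ≤ symSCr K n ι r := by
  refine le_sInf ?_
  rintro _ ⟨k, rfl, L, hcov, hL⟩
  have hfin : Finite (power K n).V := inferInstanceAs (Finite (Fin n → V))
  have := finite_sdIter (M := power K n) r
  obtain ⟨b₀, hb₀, hb₀x⟩ := exists_isWeight_power hK n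
  -- One subdivision beyond r is needed: its vertices are the simplices of sd^r, so membership in
  -- L_i can be asked of each of them.
  obtain ⟨b, hb, hbx⟩ : ∃ b : (Fin n → Realization K) → ((power K n).sdIter r).sd.V → ℝ,
      IsWeight ((power K n).sdIter r).sd b ∧
        ∀ x σ, b x σ ≠ 0 → b₀ x (ι.iter r ((ι r).toFun σ)) ≠ 0 := hb₀.exists_sdIter ι (r + 1)
  refine sInf_le ⟨k, rfl, fun i => {x | ∃ σ : ((power K n).sdIter r).sd.V,
    GComplex.verts σ ∈ (L i).faces ∧ b x σ ≠ 0}, fun i => ?_, fun i g x => ?_, ?_, fun i => ?_⟩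
  · have h : {x | ∃ σ : ((power K n).sdIter r).sd.V, GComplex.verts σ ∈ (L i).faces ∧ b x σ ≠ 0} =
        ⋃ σ ∈ {σ : ((power K n).sdIter r).sd.V | GComplex.verts σ ∈ (L i).faces},
          {x | b x σ ≠ 0} := by
      ext x
      simp
    exact (congrArg IsOpen h).mpr
      (isOpen_biUnion fun σ _ => isOpen_ne_fun (hb.continuous σ) continuous_const)
  · rintro ⟨σ, hσ, hσb⟩
    exact ⟨g • σ, (L i).invariant g _ hσ, by
      rw [show b (g • x) (g • σ) = b x σ from hb.equivariant g x σ]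
      exact hσb⟩
  · refine Set.eq_univ_of_forall fun x => ?_
    obtain ⟨s, hs, hsb⟩ := hb.support x
    obtain ⟨σ, hσ⟩ := face_nonempty hs
    obtain ⟨i, hi⟩ := hcov _ (GComplex.verts_mem (M := (power K n).sdIter r) σ)
    exact Set.mem_iUnion.mpr ⟨i, σ, hi, (hsb σ).1 hσ⟩
  · exact hasEquivariantSection_of_symContiguous ((power K n).sdIter r) (ι r) (L i)
      (fun j v => ι.iter r v j) hb (fun x σ hσ j => hb₀x x _ (hbx x σ hσ) j) (hL i)

end SectionsFromContiguity

/-! ### Estimates for averages. -/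

section Averages

variable {A : Type u} {s : Finset A} {f : A → ℝ}

theorem abs_average_sub_le {c D : ℝ} (hs : s.Nonempty) (h : ∀ a ∈ s, |f a - c| ≤ D) :
    |(∑ a ∈ s, f a) / s.card - c| ≤ D := by
  have hc : (0 : ℝ) < s.card := Nat.cast_pos.mpr hs.card_pos
  have h1 : (∑ a ∈ s, f a) / s.card - c = (∑ a ∈ s, (f a - c)) / s.card := by
    rw [Finset.sum_sub_distrib, Finset.sum_const, nsmul_eq_mul]
    field_simp
  rw [h1, abs_div, abs_of_pos hc, div_le_iff₀ hc]
  calc |∑ a ∈ s, (f a - c)| ≤ ∑ a ∈ s, |f a - c| := Finset.abs_sum_le_sum_abs _ _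
    _ ≤ ∑ _a ∈ s, D := Finset.sum_le_sum h
    _ = D * s.card := by rw [Finset.sum_const, nsmul_eq_mul, mul_comm]

/-- The term of a itself contributes zero to the mean deviation, which saves a fraction of at least
1/N. This is the contraction factor of barycentric subdivision. -/
theorem abs_sub_average_le {D : ℝ} {N : ℕ} (hN : s.card ≤ N) (hD : 0 ≤ D)
    (h : ∀ a ∈ s, ∀ b ∈ s, |f a - f b| ≤ D) {a : A} (ha : a ∈ s) :
    |f a - (∑ b ∈ s, f b) / s.card| ≤ (1 - (N : ℝ)⁻¹) * D := by
  classical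
  have hc : (0 : ℝ) < s.card := Nat.cast_pos.mpr (Finset.card_pos.mpr ⟨a, ha⟩)
  have h1 : f a - (∑ b ∈ s, f b) / s.card = (∑ b ∈ s.erase a, (f a - f b)) / s.card := by
    rw [Finset.sum_erase _ (sub_self _), Finset.sum_sub_distrib, Finset.sum_const, nsmul_eq_mul]
    field_simp
  have h2 : ((s.erase a).card : ℝ) = s.card - 1 := by
    rw [Finset.card_erase_of_mem ha, Nat.cast_sub (Finset.card_pos.mpr ⟨a, ha⟩), Nat.cast_one]
  have h3 : (N : ℝ)⁻¹ ≤ (s.card : ℝ)⁻¹ := inv_anti₀ hc (Nat.cast_le.mpr hN)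
  rw [h1, abs_div, abs_of_pos hc, div_le_iff₀ hc]
  calc |∑ b ∈ s.erase a, (f a - f b)| ≤ ∑ b ∈ s.erase a, |f a - f b| :=
        Finset.abs_sum_le_sum_abs _ _
    _ ≤ ∑ _b ∈ s.erase a, D := Finset.sum_le_sum fun b hb => h a ha b (Finset.mem_of_mem_erase hb)
    _ = (1 - (s.card : ℝ)⁻¹) * D * s.card := by
        rw [Finset.sum_const, nsmul_eq_mul, h2]
        field_simp
    _ ≤ (1 - (N : ℝ)⁻¹) * D * s.card := by gcongr

end Averages

/-- Cardinality is injective on a chain of simplices, with values in 1, …, N. Hence one contraction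
factor serves all subdivisions. -/
theorem card_le_of_mem_sd {A : Type u} {M : AbstractSimplicialComplex A} {N : ℕ}
    (hN : ∀ s ∈ M.faces, s.card ≤ N) (c : Finset M.faces) (hc : c ∈ (sd M).faces) :
    c.card ≤ N := by
  have h : (Finset.Icc 1 N).card = N := by simp
  rw [← h]
  refine Finset.card_le_card_of_injOn (fun σ => σ.1.card) (fun σ _ => ?_) ?_
  · exact Finset.mem_coe.mpr (Finset.mem_Icc.mpr
      ⟨Finset.card_pos.mpr (face_nonempty σ.2), hN σ.1 σ.2⟩)
  · intro σ hσ τ hτ h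
    rcases hc.2.total hσ hτ with h1 | h1
    · exact Subtype.ext (Finset.eq_of_subset_of_card_le h1 h.ge)
    · exact Subtype.ext (Finset.eq_of_subset_of_card_le h1 h.le).symm

/-! ### Positions of subdivision vertices and the mesh. -/

section Positions

variable {V : Type u} [PartialOrder V] {K : AbstractSimplicialComplex V} {n : ℕ}

open Classical in
/-- The coordinates in `|K|^n` of the vertices of `sd^r (K^n)`. -/
noncomputable def position (K : AbstractSimplicialComplex V) (n : ℕ) :
    ∀ r : ℕ, ((power K n).sdIter r).V → Fin n → V → ℝ
  | 0 => fun (w : Fin n → V) j v => if w j = v then 1 else 0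
  | r + 1 => fun σ j v =>
      (∑ u ∈ GComplex.verts (M := (power K n).sdIter r) σ, position K n r u j v) /
        (GComplex.verts (M := (power K n).sdIter r) σ).card

theorem position_succ (r : ℕ) (σ : ((power K n).sdIter r).sd.V) (j : Fin n) (v : V) :
    position K n (r + 1) σ j v =
      (∑ u ∈ GComplex.verts σ, position K n r u j v) / (GComplex.verts σ).card :=
  rfl

theorem position_nonneg (r : ℕ) (u : ((power K n).sdIter r).V) (j : Fin n) (v : V) :
    0 ≤ position K n r u j v := by
  classical
  induction r with
  | zero =>
    change 0 ≤ if (u : Fin n → V) j = v then (1 : ℝ) else 0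
    split_ifs <;> norm_num
  | succ r ih => exact div_nonneg (Finset.sum_nonneg fun _ _ => ih _) (Nat.cast_nonneg _)

theorem sum_position [Fintype V] (r : ℕ) (u : ((power K n).sdIter r).V) (j : Fin n) :
    ∑ v, position K n r u j v = 1 := by
  classical
  induction r with
  | zero =>
    change ∑ v, (if (u : Fin n → V) j = v then (1 : ℝ) else 0) = 1
    simp
  | succ r ih =>
    change ∑ v, (∑ w ∈ GComplex.verts (M := (power K n).sdIter r) u, position K n r w j v) /
        ((GComplex.verts (M := (power K n).sdIter r) u).card : ℝ) = 1
    rw [← Finset.sum_div, Finset.sum_comm, Finset.sum_congr rfl fun w _ => ih w, Finset.sum_const,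
      nsmul_eq_mul, mul_one]
    exact div_self (Nat.cast_ne_zero.mpr
      (Finset.card_pos.mpr (face_nonempty (GComplex.verts_mem _))).ne')

theorem position_support (r : ℕ) : ∀ s ∈ ((power K n).sdIter r).cx.faces, ∀ j,
    ∃ t ∈ K.faces, ∀ u ∈ s, ∀ v, position K n r u j v ≠ 0 → v ∈ t := by
  classical
  induction r with
  | zero =>
    intro s hs j
    refine ⟨_, hs.2.2 j, fun u hu v hv => ?_⟩
    change (if (u : Fin n → V) j = v then (1 : ℝ) else 0) ≠ 0 at hv
    by_cases h : (u : Fin n → V) j = v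
    · rw [← h]
      exact Finset.mem_image_of_mem (fun x : Fin n → V => x j) hu
    · exact absurd (if_neg h) hv
  | succ r ih =>
    intro c hc j
    obtain ⟨τ, -, hmax⟩ := exists_greatest (P := ((power K n).sdIter r).cx.faces) c hc.1 hc.2
    obtain ⟨t, ht, hv⟩ := ih τ.1 τ.2 j
    refine ⟨t, ht, fun σ hσ v hne => ?_⟩
    by_contra hvt
    refine hne ((position_succ r σ j v).trans ?_)
    rw [Finset.sum_eq_zero, zero_div]
    intro u hu
    by_contra h0
    exact hvt (hv u (hmax σ hσ hu) v h0)

/-- The point of `|K|^n` at which a vertex of `sd^r (K^n)` is placed. -/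
noncomputable def point [Finite V] (K : AbstractSimplicialComplex V) (n r : ℕ)
    (u : ((power K n).sdIter r).V) : Fin n → Realization K := fun j =>
  ⟨position K n r u j, by
    have := Fintype.ofFinite V
    obtain ⟨t, ht, h⟩ := position_support r {u} (((power K n).sdIter r).cx.singleton_mem u) j
    exact realization_mem (position_nonneg r u j) (sum_position r u j) ht
      (h u (Finset.mem_singleton_self u))⟩

theorem position_smul (r : ℕ) (g : Sym n) (u : ((power K n).sdIter r).V) (j : Fin n) :
    position K n r (g • u) j = position K n r u (perm g j) := by
  induction r with
  | zero => rfl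
  | succ r ih =>
    funext v
    change (∑ w ∈ (GComplex.verts (M := (power K n).sdIter r) u).map
        (MulAction.toPerm g).toEmbedding, position K n r w j v) /
        (((GComplex.verts (M := (power K n).sdIter r) u).map
          (MulAction.toPerm g).toEmbedding).card : ℝ) = _
    rw [Finset.sum_map, Finset.card_map]
    refine congrArg (· / _) (Finset.sum_congr rfl fun w _ => ?_)
    exact congrFun (ih w) v

theorem point_smul [Finite V] (r : ℕ) (g : Sym n) (u : ((power K n).sdIter r).V) :
    point K n r (g • u) = g • point K n r u :=
  funext fun j => Subtype.ext (position_smul r g u j)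

theorem position_succ_ne_zero (r : ℕ) (σ : ((power K n).sdIter r).sd.V) (j : Fin n) (v : V)
    {u : ((power K n).sdIter r).V} (hu : u ∈ GComplex.verts σ) (h : position K n r u j v ≠ 0) :
    position K n (r + 1) σ j v ≠ 0 := by
  rw [position_succ]
  refine div_ne_zero (Finset.sum_pos' (fun w _ => position_nonneg r w j v) ⟨u, hu, ?_⟩).ne' ?_
  · exact lt_of_le_of_ne (position_nonneg r u j v) h.symm
  · exact Nat.cast_ne_zero.mpr (Finset.card_pos.mpr ⟨u, hu⟩).ne'

theorem position_iter_ne_zero (ι : (power K n).ApproxSystem) (r : ℕ)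
    (u : ((power K n).sdIter r).V) (j : Fin n) : position K n r u j (ι.iter r u j) ≠ 0 := by
  classical
  induction r with
  | zero =>
    change (if (u : Fin n → V) j = (u : Fin n → V) j then (1 : ℝ) else 0) ≠ 0
    simp
  | succ r ih => exact position_succ_ne_zero r u j _ ((ι r).mem u) (ih ((ι r).toFun u))

/-- Two vertices of a subdivided simplex are barycentres of nested simplices σ ⊆ τ. The barycentre
of σ averages vertices of τ, each of which is within (1 - 1/N) times the old mesh of the barycentre
of τ. -/
theorem exists_mesh_bound [Finite V] (K : AbstractSimplicialComplex V) (n : ℕ) :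
    ∃ q : ℝ, 0 ≤ q ∧ q < 1 ∧ ∀ r, ∀ s ∈ ((power K n).sdIter r).cx.faces, ∀ u ∈ s, ∀ u' ∈ s,
      ∀ j v, |position K n r u j v - position K n r u' j v| ≤ q ^ r := by
  classical
  have := Fintype.ofFinite V
  -- The +1 keeps N positive when there are no vertices.
  let N : ℕ := Fintype.card (Fin n → V) + 1
  have hN : ∀ r, ∀ s ∈ ((power K n).sdIter r).cx.faces, s.card ≤ N := by
    intro r
    induction r with
    | zero =>
      intro s _
      exact (Finset.card_le_univ (α := Fin n → V) s).trans (Nat.le_succ _)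
    | succ r ih => exact card_le_of_mem_sd ih
  have hN1 : (1 : ℝ) ≤ N := by exact_mod_cast Nat.succ_le_succ (Nat.zero_le _)
  have hq : 0 ≤ 1 - (N : ℝ)⁻¹ := sub_nonneg.mpr (inv_le_one_of_one_le₀ hN1)
  refine ⟨1 - (N : ℝ)⁻¹, hq, sub_lt_self _ (by positivity), fun r => ?_⟩
  induction r with
  | zero =>
    intro s _ u _ u' _ j v
    change |(if (u : Fin n → V) j = v then (1 : ℝ) else 0) -
      if (u' : Fin n → V) j = v then 1 else 0| ≤ _
    split_ifs <;> norm_num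
  | succ r ih =>
    have key : ∀ σ τ : ((power K n).sdIter r).sd.V, GComplex.verts σ ⊆ GComplex.verts τ → ∀ j v,
        |position K n (r + 1) σ j v - position K n (r + 1) τ j v| ≤
          (1 - (N : ℝ)⁻¹) ^ (r + 1) := by
      intro σ τ h j v
      rw [position_succ, position_succ, pow_succ']
      refine abs_average_sub_le (face_nonempty (GComplex.verts_mem σ)) fun u hu => ?_
      exact abs_sub_average_le (f := fun w => position K n r w j v)
        (hN r _ (GComplex.verts_mem τ)) (pow_nonneg hq r)
        (fun a ha b hb => ih _ (GComplex.verts_mem τ) a ha b hb j v) (h hu)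
    intro c hc σ hσ τ hτ j v
    rcases IsChain.total (α := ((power K n).sdIter r).cx.faces) hc.2 hσ hτ with h | h
    · exact key σ τ h j v
    · rw [abs_sub_comm]
      exact key τ σ h j v

theorem dist_point_le [Fintype V] {r r' : ℕ} {u : ((power K n).sdIter r).V}
    {u' : ((power K n).sdIter r').V} {D : ℝ} (hD : 0 ≤ D)
    (h : ∀ j v, |position K n r u j v - position K n r' u' j v| ≤ D) :
    dist (point K n r u) (point K n r' u') ≤ D := by
  refine (dist_pi_le_iff hD).mpr fun j => ?_
  rw [Subtype.dist_eq]
  exact (dist_pi_le_iff hD).mpr fun v => h j v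

end Positions

/-! ### From sections to symmetric contiguity. -/

section ContiguityFromSections

variable {V : Type u} {K : AbstractSimplicialComplex V} {n : ℕ}

theorem dist_coord_lt [Fintype V] {x y : Fin n → Realization K} {δ : ℝ} (h : dist x y < δ)
    (j : Fin n) (v : V) : |(x j).1 v - (y j).1 v| < δ :=
  ((dist_le_pi_dist (x j).1 (y j).1 v).trans (dist_le_pi_dist x y j)).trans_lt h

/-- Chosen vertices depend only on the predicate. This makes them equivariant, and independent of j
at time 0, without any symmetrisation. -/
theorem choose_congr {α : Type u} {p q : α → Prop} (hp : ∃ a, p a) (hq : ∃ a, q a) (h : p = q) :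
    hp.choose = hq.choose := by
  subst h
  rfl

variable [PartialOrder V]

/-- A uniformly continuous equivariant homotopy on a set that contains the vertices of a symmetric
subcomplex of a sufficiently fine subdivision gives a symmetric contiguity. -/
theorem symContiguous_of_homotopy [Fintype V] (hn : 0 < n) (ι : (power K n).ApproxSystem) (r : ℕ)
    (L : InvSubcomplex ((power K n).sdIter r)) {C : Set (Fin n → Realization K)}
    (hC : ∀ s ∈ L.faces, ∀ u ∈ s, point K n r u ∈ C)
    (H : C → unitInterval → Fin n → Realization K)
    (h0 : ∀ x i j, H x 0 i = H x 0 j) (h1 : ∀ x, H x 1 = x)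
    (hH : ∀ (g : Sym n) (x y : C), (y : Fin n → Realization K) = g • (x : Fin n → Realization K) →
      ∀ t, H y t = g • H x t)
    {ε q : ℝ} (hε : 0 < ε)
    (hunif : ∀ x y t t', dist x y < ε → dist t t' < ε →
      dist (H x t) (H y t') < ((Fintype.card V : ℝ) + 1)⁻¹)
    (hmesh : ∀ s ∈ ((power K n).sdIter r).cx.faces, ∀ u ∈ s, ∀ u' ∈ s,
      ∀ j v, |position K n r u j v - position K n r u' j v| ≤ q)
    (hq : 0 ≤ q) (hqε : q < ε) (hqδ : q < ((Fintype.card V : ℝ) + 1)⁻¹) :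
    SymContiguous L.toGComplex K fun j v => ι.iter r v.1 j := by
  classical
  set δ : ℝ := ((Fintype.card V : ℝ) + 1)⁻¹
  obtain ⟨m, hm⟩ := exists_nat_one_div_lt hε
  set c : ℕ := m + 1 with hc
  have hcpos : (0 : ℝ) < c := by positivity
  let t : ℕ → unitInterval := fun l => Set.projIcc 0 1 zero_le_one ((l : ℝ) / c)
  have ht0 : t 0 = 0 := by
    simp only [t, Nat.cast_zero, zero_div]
    exact Set.projIcc_left zero_le_one
  have ht1 : t c = 1 := by
    simp only [t]
    rw [div_self hcpos.ne']
    exact Set.projIcc_right zero_le_one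
  have htt : ∀ l, dist (t (l + 1)) (t l) < ε := by
    intro l
    rw [Subtype.dist_eq, Real.dist_eq]
    refine (Set.abs_projIcc_sub_projIcc zero_le_one).trans_lt ?_
    rw [← sub_div, Nat.cast_add, Nat.cast_one, add_sub_cancel_left, abs_of_pos (by positivity), hc,
      Nat.cast_add, Nat.cast_one]
    exact hm
  let P : L.toGComplex.V → C := fun v => ⟨point K n r v.1, hC _ v.2 _ (Finset.mem_singleton_self _)⟩
  have hPg : ∀ g v, (P (g • v)).1 = g • (P v).1 := fun g v => point_smul r g v.1
  let Q : Fin n → ℕ → L.toGComplex.V → V → Prop := fun j l v w => δ ≤ (H (P v) (t l) j).1 w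
  have hQ : ∀ j l v, ∃ w, Q j l v w := fun j l v => Realization.exists_large _
  have hQg : ∀ j l (g : Sym n) v, Q j l (g • v) = Q (perm g j) l v := by
    intro j l g v
    simp only [Q, hH g _ _ (hPg g v)]
    rfl
  let φ : Fin n → ℕ → L.toGComplex.V → V := fun j l v => (hQ j l v).choose
  let π : Fin n → L.toGComplex.V → V := fun j v => ι.iter r v.1 j
  -- Beyond the last sample c the chain is π_j, so its length is c + 1.
  let ψ : Fin n → ℕ → L.toGComplex.V → V := fun j l => if l ≤ c then φ j l else π j
  have hπg : ∀ j (g : Sym n) v, π j (g • v) = π (perm g j) v := fun j g v =>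
    congrFun (ι.iter_smul r g v.1) j
  have hφg : ∀ j l (g : Sym n) v, φ j l (g • v) = φ (perm g j) l v := fun j l g v =>
    choose_congr _ _ (hQg j l g v)
  have hψg : ∀ j l (g : Sym n) v, ψ j l (g • v) = ψ (perm g j) l v := by
    intro j l g v
    simp only [ψ]
    split_ifs
    · exact hφg j l g v
    · exact hπg j g v
  have hφ0 : ∀ i j, φ i 0 = φ j 0 := by
    intro i j
    funext v
    refine choose_congr _ _ ?_
    simp only [Q]
    rw [ht0, h0 (P v) i j]
  have hψ0 : ∀ j, ψ j 0 = φ j 0 := fun j => if_pos (Nat.zero_le c)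
  have hψc : ∀ j, ψ j (c + 1) = π j := fun j => if_neg (by omega)
  have hface : ∀ s ∈ L.toGComplex.cx.faces, ∃ s' ∈ ((power K n).sdIter r).cx.faces,
      ∀ v ∈ s, v.1 ∈ s' := fun s hs =>
    ⟨_, L.subset_faces hs, fun v hv => Finset.mem_map_of_mem (Function.Embedding.subtype _) hv⟩
  have hφlarge : ∀ (z : Fin n → Realization K) j l v, dist (H (P v) (t l)) z < δ →
      (z j).1 (φ j l v) ≠ 0 := by
    intro z j l v hz h
    have h2 : δ ≤ (H (P v) (t l) j).1 (φ j l v) := (hQ j l v).choose_spec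
    have h3 := (abs_lt.mp (dist_coord_lt hz j (φ j l v))).2
    rw [h] at h3
    linarith
  have hstep : ∀ j, ∀ l < c + 1, OneContiguous L.toGComplex.cx K (ψ j l) (ψ j (l + 1)) := by
    intro j l hl s hs
    obtain ⟨v₀, hv₀⟩ := face_nonempty hs
    obtain ⟨s', hs', hss'⟩ := hface s hs
    -- It is enough to find one point whose j-th support contains all the vertices in question.
    suffices h : ∃ z : Fin n → Realization K, ∀ v ∈ s,
        (z j).1 (ψ j l v) ≠ 0 ∧ (z j).1 (ψ j (l + 1) v) ≠ 0 by
      obtain ⟨z, hz⟩ := h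
      obtain ⟨S, hS, hzS⟩ := (z j).exists_face
      refine face_of_subset hS (fun w hw => ?_)
        ⟨_, Finset.mem_union_left _ (Finset.mem_image_of_mem _ hv₀)⟩
      rcases Finset.mem_union.mp hw with hw | hw
      · obtain ⟨v, hv, rfl⟩ := Finset.mem_image.mp hw
        exact (hzS _).2 (hz v hv).1
      · obtain ⟨v, hv, rfl⟩ := Finset.mem_image.mp hw
        exact (hzS _).2 (hz v hv).2
    rcases Nat.lt_or_ge l c with hlc | hlc
    · have hPd : ∀ v ∈ s, dist (P v) (P v₀) < ε := fun v hv =>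
        (dist_point_le hq (hmesh s' hs' _ (hss' v hv) _ (hss' v₀ hv₀))).trans_lt hqε
      refine ⟨H (P v₀) (t l), fun v hv => ?_⟩
      simp only [ψ]
      rw [if_pos hlc.le, if_pos (Nat.succ_le_of_lt hlc)]
      exact ⟨hφlarge _ j l v (hunif _ _ _ _ (hPd v hv) ((dist_self _).trans_lt hε)),
        hφlarge _ j (l + 1) v (hunif _ _ _ _ (hPd v hv) (htt l))⟩
    -- At time 1 the motion is the inclusion, so the barycentre of the simplex serves as z: it is
    -- closer than δ to each vertex, and its support contains the supports of the vertices, where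
    -- π_j takes its values.
    · have hlc' : l = c := by omega
      subst hlc'
      let σ : ((power K n).sdIter r).sd.V := ⟨s', hs'⟩
      refine ⟨point K n (r + 1) σ, fun v hv => ?_⟩
      rw [hψc]
      refine ⟨?_, position_succ_ne_zero r σ j _ (hss' v hv) (position_iter_ne_zero ι r v.1 j)⟩
      simp only [ψ]
      rw [if_pos hlc]
      refine hφlarge _ j _ v ?_
      rw [ht1, h1]
      refine (dist_point_le hq fun j w => ?_).trans_lt hqδ
      rw [position_succ, abs_sub_comm]
      exact abs_average_sub_le ⟨v.1, hss' v hv⟩ fun u hu =>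
        hmesh s' hs' u hu v.1 (hss' v hv) j w
  have hsimp : ∀ j, ∀ l ≤ c + 1, IsSimplicial L.toGComplex.cx K (ψ j l) := by
    intro j l hl s hs
    rcases Nat.lt_or_ge l (c + 1) with h | h
    · exact face_of_subset (hstep j l h s hs) Finset.subset_union_left ((face_nonempty hs).image _)
    · have h' : l = c + 1 := by omega
      subst h'
      exact face_of_subset (hstep j c (Nat.lt_succ_self c) s hs) Finset.subset_union_right
        ((face_nonempty hs).image _)
  have hstar : ∀ j, ψ j 0 = φ ⟨0, hn⟩ 0 := fun j => (hψ0 j).trans (hφ0 _ _)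
  refine ⟨fun j => ?_, hπg, φ ⟨0, hn⟩ 0, c + 1, ψ, ?_, fun g v => ?_, by omega, hstar, hψc, hsimp,
    hstep, fun j l _ _ => hψg j l⟩
  · have h := hsimp j (c + 1) le_rfl
    rw [hψc] at h
    exact h
  · have h := hsimp ⟨0, hn⟩ 0 (Nat.zero_le _)
    rw [hstar] at h
    exact h
  · rw [hφg, hφ0]

/-- The points whose `ρ`-neighbourhood is contained in `U`. -/
def innerCore {X : Type u} [PseudoMetricSpace X] (U : Set X) (ρ : ℝ) : Set X :=
  {x | Metric.ball x ρ ⊆ U}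

theorem isClosed_innerCore {X : Type u} [PseudoMetricSpace X] (U : Set X) (ρ : ℝ) :
    IsClosed (innerCore U ρ) := by
  have h : innerCore U ρ = ⋂ y ∈ Uᶜ, {x | ρ ≤ dist y x} := by
    ext x
    simp only [innerCore, Set.mem_iInter, Set.mem_compl_iff, Set.mem_ofPred_eq]
    constructor
    · intro h y hy
      by_contra hlt
      exact hy (h (not_le.mp hlt))
    · intro h y hy
      by_contra hyU
      exact absurd hy (not_lt.mpr (h y hyU))
  rw [h]
  exact isClosed_biInter fun y _ => isClosed_le continuous_const (continuous_const.dist continuous_id)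

/-- Permuting coordinates is an isometry of the sup metric, so it carries balls to balls. -/
theorem smul_mem_innerCore {X : Type u} [PseudoMetricSpace X] {U : Set (Fin n → X)}
    (hU : ∀ g : Sym n, ∀ x ∈ U, g • x ∈ U) {ρ : ℝ} (hρ : 0 < ρ) (g : Sym n) {x : Fin n → X}
    (hx : x ∈ innerCore U ρ) : g • x ∈ innerCore U ρ := by
  intro y hy
  have h : g⁻¹ • y ∈ Metric.ball x ρ := by
    rw [Metric.mem_ball, dist_pi_lt_iff hρ] at hy ⊢
    intro j
    have h1 := hy (perm g⁻¹ j)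
    have h2 : (g • x) (perm g⁻¹ j) = (g⁻¹ • g • x) j := rfl
    rw [h2, inv_smul_smul] at h1
    exact h1
  have h3 := hU g _ (hx h)
  rwa [smul_inv_smul] at h3

theorem exists_symSCr_le [Finite V] (hn : 0 < n) (ι : (power K n).ApproxSystem) {k : ℕ}
    (U : Fin k → Set (Fin n → Realization K)) (hUo : ∀ i, IsOpen (U i))
    (hUg : ∀ i, ∀ g : Sym n, ∀ x ∈ U i, g • x ∈ U i) (hcov : (⋃ i, U i) = Set.univ)
    (hs : ∀ i, HasEquivariantSection (Sym n) (evalEnds n (Realization K)) (U i)) :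
    ∃ r, symSCr K n ι r ≤ k := by
  classical
  have := Fintype.ofFinite V
  obtain ⟨ρ, hρ, hleb⟩ := lebesgue_number_lemma_of_metric isCompact_univ hUo hcov.ge
  -- Half of the Lebesgue number is the margin of the cores, the other half bounds the simplices;
  -- together they put every simplex into some L_i.
  have hρ2 : 0 < ρ / 2 := by positivity
  let C : Fin k → Set (Fin n → Realization K) := fun i => innerCore (U i) (ρ / 2)
  have hCU : ∀ i, C i ⊆ U i := fun i x hx => hx (Metric.mem_ball_self hρ2)
  have hCc : ∀ i, CompactSpace (C i) := fun i =>
    isCompact_iff_compactSpace.mp (isClosed_innerCore (U i) (ρ / 2)).isCompact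
  choose s hsc hse hsg using hs
  let H : ∀ i, C i → unitInterval → Fin n → Realization K := fun i x t j =>
    s i ⟨x.1, hCU i x.2⟩ (Wedge.pt t j)
  have hHc : ∀ i, Continuous fun p : C i × unitInterval => H i p.1 p.2 := by
    intro i
    refine continuous_pi fun j => ?_
    have hpt : Continuous fun t : unitInterval => (Wedge.pt t j : Wedge n) :=
      continuous_quot_mk.comp (continuous_id.prodMk continuous_const)
    have h1 : Continuous fun x : C i => (s i ⟨x.1, hCU i x.2⟩).comp ⟨_, hpt⟩ :=
      (ContinuousMap.continuous_precomp _).comp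
        ((hsc i).comp (continuous_subtype_val.subtype_mk _))
    exact (h1.comp continuous_fst).eval continuous_snd
  have hunif : ∀ i, ∃ ε > 0, ∀ x y t t', dist x y < ε → dist t t' < ε →
      dist (H i x t) (H i y t') < ((Fintype.card V : ℝ) + 1)⁻¹ := by
    intro i
    have := hCc i
    obtain ⟨ε, hε, h⟩ := Metric.uniformContinuous_iff.mp
      (CompactSpace.uniformContinuous_of_continuous (hHc i)) ((Fintype.card V : ℝ) + 1)⁻¹
      (by positivity)
    exact ⟨ε, hε, fun x y t t' hxy ht => h (a := (x, t)) (b := (y, t')) (max_lt hxy ht)⟩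
  choose ε hε hεH using hunif
  obtain ⟨q, hq0, hq1, hmesh⟩ := exists_mesh_bound K n
  have hsmall : ∀ {e : ℝ}, 0 < e → ∀ᶠ r in Filter.atTop, q ^ r < e := fun he =>
    (tendsto_pow_atTop_nhds_zero_of_lt_one hq0 hq1).eventually (gt_mem_nhds he)
  have hall : ∀ᶠ r in Filter.atTop, ∀ i, q ^ r < ε i :=
    Filter.eventually_all.mpr fun i => hsmall (hε i)
  have hδ : (0 : ℝ) < ((Fintype.card V : ℝ) + 1)⁻¹ := by positivity
  -- The mesh must beat the moduli of continuity of the finitely many motions, the coordinate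
  -- threshold, and the margin of the cores.
  obtain ⟨r, hr1, hr2, hr3⟩ := (hall.and ((hsmall hδ).and (hsmall hρ2))).exists
  let L : Fin k → InvSubcomplex ((power K n).sdIter r) := fun i =>
    { faces := {t | t ∈ ((power K n).sdIter r).cx.faces ∧ ∀ u ∈ t, point K n r u ∈ C i}
      isRelLowerSet_faces := fun t ht => ⟨face_nonempty ht.1, fun t' htt' ht' =>
        ⟨face_of_subset ht.1 htt' ht', fun u hu => ht.2 u (htt' hu)⟩⟩
      subset_faces := fun t ht => ht.1
      invariant := fun g t ht => ⟨((power K n).sdIter r).map_face g t ht.1, fun u hu => by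
        obtain ⟨u', hu', rfl⟩ := Finset.mem_map.mp hu
        change point K n r (g • u') ∈ C i
        rw [point_smul]
        exact smul_mem_innerCore (hUg i) hρ2 g (ht.2 u' hu')⟩ }
  refine ⟨r, sInf_le ⟨k, rfl, L, fun t ht => ?_, fun i => ?_⟩⟩
  · obtain ⟨u₀, hu₀⟩ := face_nonempty ht
    obtain ⟨i, hi⟩ := hleb (point K n r u₀) trivial
    refine ⟨i, ht, fun u hu => (Metric.ball_subset_ball' ?_).trans hi⟩
    have h := dist_point_le (pow_nonneg hq0 r) (hmesh r t ht u hu u₀ hu₀)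
    linarith
  · refine symContiguous_of_homotopy hn ι r (L i) (fun t ht => ht.2) (H i) ?_ ?_ ?_ (hε i) (hεH i)
      (hmesh r) (pow_nonneg hq0 r) (hr1 i) hr2
    · intro x a b
      exact congrArg (s i ⟨x.1, hCU i x.2⟩) (Quotient.sound (Or.inr ⟨rfl, rfl⟩))
    · exact fun x => hse i ⟨x.1, hCU i x.2⟩
    · intro g x y hxy t
      funext j
      change s i ⟨y.1, hCU i y.2⟩ (Wedge.pt t j) = s i ⟨x.1, hCU i x.2⟩ (Wedge.pt t (perm g j))
      rw [hsg i g ⟨x.1, hCU i x.2⟩ ⟨y.1, hCU i y.2⟩ hxy]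
      rfl

theorem symSC_le_symTC [Finite V] (hn : 0 < n) (ι : (power K n).ApproxSystem) :
    symSC K n ι ≤ symTC n (Realization K) := by
  refine le_sInf ?_
  rintro _ ⟨k, rfl, U, hUo, hUg, hcov, hs⟩
  obtain ⟨r, hr⟩ := exists_symSCr_le hn ι U hUo hUg hcov hs
  exact (iInf_le _ r).trans hr

end ContiguityFromSections

end HigherSym

theorem theoremA {V : Type u} [Finite V] [PartialOrder V] (K : AbstractSimplicialComplex V)
    (hK : HigherSym.IsOrderedComplex K) (n : ℕ) (hn : 2 ≤ n)
    (ι : (HigherSym.power K n).ApproxSystem) :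
    HigherSym.symSC K n ι = HigherSym.symTC n (HigherSym.Realization K) :=
  le_antisymm (HigherSym.symSC_le_symTC (by omega) ι)
    (le_iInf fun r => HigherSym.symTC_le_symSCr hK ι r)
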